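/- Let $\Bbbk$ be a field. Let $\mathcal{TL}_0(\Bbbk)$ be the strict $\Bbbk$-linear monoidal category with objects $0,1,2,\dots$, tensor product $m\otimes n=m+n$ and unit object $0$, generated by morphisms $\mathrm{cup}:0\to 2$ and $\mathrm{cap}:2\to 0$ subject to the relations $(\mathrm{id}_1\otimes\mathrm{cap})\circ(\mathrm{cup}\otimes\mathrm{id}_1)=0=(\mathrm{cap}\otimes\mathrm{id}_1)\circ(\mathrm{id}_1\otimes\mathrm{cup})$ and $\mathrm{cap}\circ\mathrm{cup}=\mathrm{id}_0$. Let $f\mapsto\overline f$ be the contravariant $\Bbbk$-linear monoidal functor that fixes objects and exchanges $\mathrm{cup}$ and $\mathrm{cap}$. A cap diagram on $n$ strands consists of non-crossing caps joining disjoint pairs of the points $1,\dots,n$, such that no uncapped point lies below a cap; the uncapped points are its through strands, and $\mathtt{th}(x)$ is their number. A cap diagram $x$ is identified with the morphism $n\to \mathtt{th}(x)$ that it depicts. Let $\mathscr D_n$ be the set of cap diagrams on $n$ strands, and for $x\in\mathscr D_n$ let $\vartheta(x)\in\mathscr D_n$ be its left-right reflection. Let $$\mathrm j_n=\sum_{I}(-1)^{|I|}\,\overline{\mathrm{cap}_{I,n}}\circ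 \mathrm{cap}_{I,n}\in\mathrm{End}(n)$$ be the Jones--Wenzl projector, where $I$ runs over the subsets of $\{1,\dots,n-1\}$ without two consecutive elements and $\mathrm{cap}_{I,n}\in\mathscr D_n$ has caps exactly at the pairs $(i,i+1)$, $i\in I$. For $x\in\mathscr D_{m+n}$ let $x_{\le m}\in\mathscr D_m$ (resp. $x_{>m}\in\mathscr D_n$) be obtained by deleting the last $n$ (resp. first $m$) strands and turning half-caps into through strands, and let $\mathtt{hk}_m(x)$ be the number $l$ with $\mathtt{th}(x)+2l=\mathtt{th}(x_{\le m})+\mathtt{th}(x_{>m})$. For $y\in\mathscr D_n$ and $y'\in\mathscr D_m$ let $y\odot_l y'\in\mathscr D_{n+m}$ be obtained by placing $y'$ to the right of $y$ and, $l$ times, joining the rightmost remaining through strand of $y$ with the leftmost remaining through strand of $y'$ by a cap. Put $\kappa_{m,n}(x)=x_{>m}\odot_{\mathtt{hk}_m(x)}x_{\le m}$, and define the commutor $$\sigma_{m,n}=\sum_{x\in\mathscr D_{m+n}}\overline{\kappa_{m,n}(x)}\circ \mathrm j_{\mathtt{th}(x)}\circ x:\ m\otimes n\to n\otimes m .$$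 For $1\le p\le r<q\le n$ let $\sigma_{p,r,q}=\mathrm{id}_{p-1}\otimes\sigma_{r-p+1,\,q-r}\otimes\mathrm{id}_{n-q}\in\mathrm{End}(n)$, and for $1\le p<q\le n$ define the interval-reversal morphisms $s_{p,q}\in\mathrm{End}(n)$ of $n=1^{\otimes n}$ recursively by $s_{p,p+1}=\sigma_{p,p,p+1}$ and $s_{p,q}=\sigma_{p,p,q}\circ s_{p+1,q}$ for $q>p+1$. Then for all $1\le p<q\le n$, $$s_{p,q}=\mathrm{id}_{p-1}\otimes\Bigl(\sum_{x\in\mathscr D_{q-p+1}}\overline{\vartheta(x)}\circ \mathrm j_{\mathtt{th}(x)}\circ x\Bigr)\otimes\mathrm{id}_{n-q}.$$ -/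

import Mathlib

namespace CrysTL

/-! ## The category `TL₀(k)` by generators and relations

The strict `k`-linear monoidal category with objects the natural numbers, `m ⊗ n = m + n`, unit
`0`, generated by `cup : 0 → 2` and `cap : 2 → 0`, where both zig-zags are `0` and the circle
is `id₀`. -/

/-- Formal morphism expressions. -/
inductive Pre (k : Type*) : ℕ → ℕ → Type _
  | cup : Pre k 0 2
  | cap : Pre k 2 0
  | id (n : ℕ) : Pre k n n
  | comp {a b c : ℕ} (g : Pre k b c) (f : Pre k a b) : Pre k a c
  | tensor {a b c d : ℕ} (f : Pre k a b) (g : Pre k c d) : Pre k (a + c) (b + d)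
  | zero (a b : ℕ) : Pre k a b
  | add {a b : ℕ} (f g : Pre k a b) : Pre k a b
  | smul {a b : ℕ} (r : k) (f : Pre k a b) : Pre k a b

/-- The congruence imposed on formal expressions: the axioms of a strict `k`-linear monoidal
category together with the zig-zag and circle relations. It relates expressions whose sources and
targets are equal numbers, but perhaps written differently, such as `(a + b) + c` and
`a + (b + c)`; this is how strictness is expressed. -/
inductive Rel {k : Type*} [CommRing k] :
    ∀ {a b a' b' : ℕ}, Pre k a b → Pre k a' b' → Prop
  -- equivalence relation, compatible with all operations
  | refl {a b : ℕ} (f : Pre k a b) : Rel f f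
  | symm {a b a' b' : ℕ} {f : Pre k a b} {f' : Pre k a' b'} : Rel f f' → Rel f' f
  | trans {a b a' b' a'' b'' : ℕ} {f : Pre k a b} {f' : Pre k a' b'} {f'' : Pre k a'' b''} :
      Rel f f' → Rel f' f'' → Rel f f''
  | comp_congr {a b c a' b' c' : ℕ} {g : Pre k b c} {f : Pre k a b}
      {g' : Pre k b' c'} {f' : Pre k a' b'} :
      Rel g g' → Rel f f' → Rel (g.comp f) (g'.comp f')
  | tensor_congr {a b c d a' b' c' d' : ℕ} {f : Pre k a b} {g : Pre k c d}
      {f' : Pre k a' b'} {g' : Pre k c' d'} :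
      Rel f f' → Rel g g' → Rel (f.tensor g) (f'.tensor g')
  | add_congr {a b a' b' : ℕ} {f g : Pre k a b} {f' g' : Pre k a' b'} :
      Rel f f' → Rel g g' → Rel (f.add g) (f'.add g')
  | smul_congr {a b a' b' : ℕ} (r : k) {f : Pre k a b} {f' : Pre k a' b'} :
      Rel f f' → Rel (f.smul r) (f'.smul r)
  -- category axioms
  | id_comp {a b : ℕ} (f : Pre k a b) : Rel ((Pre.id b).comp f) f
  | comp_id {a b : ℕ} (f : Pre k a b) : Rel (f.comp (Pre.id a)) f
  | comp_assoc {a b c d : ℕ} (h : Pre k c d) (g : Pre k b c) (f : Pre k a b) :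
      Rel ((h.comp g).comp f) (h.comp (g.comp f))
  -- strict monoidal axioms
  | tensor_id (a b : ℕ) : Rel ((Pre.id a : Pre k a a).tensor (Pre.id b)) (Pre.id (a + b) : Pre k _ _)
  | interchange {a b c a' b' c' : ℕ} (g : Pre k b c) (f : Pre k a b)
      (g' : Pre k b' c') (f' : Pre k a' b') :
      Rel ((g.comp f).tensor (g'.comp f')) ((g.tensor g').comp (f.tensor f'))
  | tensor_assoc {a b c d e e' : ℕ} (f : Pre k a b) (g : Pre k c d) (h : Pre k e e') :
      Rel ((f.tensor g).tensor h) (f.tensor (g.tensor h))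
  | unit_tensor {a b : ℕ} (f : Pre k a b) : Rel ((Pre.id 0).tensor f) f
  | tensor_unit {a b : ℕ} (f : Pre k a b) : Rel (f.tensor (Pre.id 0)) f
  -- the hom sets are `k`-modules
  | add_assoc {a b : ℕ} (f g h : Pre k a b) : Rel ((f.add g).add h) (f.add (g.add h))
  | add_comm {a b : ℕ} (f g : Pre k a b) : Rel (f.add g) (g.add f)
  | zero_add {a b : ℕ} (f : Pre k a b) : Rel ((Pre.zero a b).add f) f
  | one_smul {a b : ℕ} (f : Pre k a b) : Rel (f.smul 1) f
  | mul_smul {a b : ℕ} (r s : k) (f : Pre k a b) : Rel (f.smul (r * s)) ((f.smul s).smul r)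
  | smul_add {a b : ℕ} (r : k) (f g : Pre k a b) :
      Rel ((f.add g).smul r) ((f.smul r).add (g.smul r))
  | add_smul {a b : ℕ} (r s : k) (f : Pre k a b) :
      Rel (f.smul (r + s)) ((f.smul r).add (f.smul s))
  | zero_smul {a b : ℕ} (f : Pre k a b) : Rel (f.smul 0) (Pre.zero a b)
  -- composition and tensor product are bilinear
  | comp_add {a b c : ℕ} (g : Pre k b c) (f f' : Pre k a b) :
      Rel (g.comp (f.add f')) ((g.comp f).add (g.comp f'))
  | add_comp {a b c : ℕ} (g g' : Pre k b c) (f : Pre k a b) :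
      Rel ((g.add g').comp f) ((g.comp f).add (g'.comp f))
  | comp_smul {a b c : ℕ} (r : k) (g : Pre k b c) (f : Pre k a b) :
      Rel (g.comp (f.smul r)) ((g.comp f).smul r)
  | smul_comp {a b c : ℕ} (r : k) (g : Pre k b c) (f : Pre k a b) :
      Rel ((g.smul r).comp f) ((g.comp f).smul r)
  | tensor_add {a b c d : ℕ} (g : Pre k a b) (f f' : Pre k c d) :
      Rel (g.tensor (f.add f')) ((g.tensor f).add (g.tensor f'))
  | add_tensor {a b c d : ℕ} (g g' : Pre k a b) (f : Pre k c d) :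
      Rel ((g.add g').tensor f) ((g.tensor f).add (g'.tensor f))
  | tensor_smul {a b c d : ℕ} (r : k) (g : Pre k a b) (f : Pre k c d) :
      Rel (g.tensor (f.smul r)) ((g.tensor f).smul r)
  | smul_tensor {a b c d : ℕ} (r : k) (g : Pre k a b) (f : Pre k c d) :
      Rel ((g.smul r).tensor f) ((g.tensor f).smul r)
  -- the two zig-zags vanish and the circle is the identity of the unit object
  | zigzag_left :
      Rel (((Pre.id 1).tensor Pre.cap : Pre k (1 + 2) (1 + 0)).comp
        (Pre.cup.tensor (Pre.id 1) : Pre k (0 + 1) (2 + 1))) (Pre.zero 1 1 : Pre k 1 1)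
  | zigzag_right :
      Rel ((Pre.cap.tensor (Pre.id 1) : Pre k (2 + 1) (0 + 1)).comp
        ((Pre.id 1).tensor Pre.cup : Pre k (1 + 0) (1 + 2))) (Pre.zero 1 1 : Pre k 1 1)
  | circle : Rel ((Pre.cap : Pre k 2 0).comp Pre.cup) (Pre.id 0 : Pre k 0 0)

/-- The morphisms `a → b` of `TL₀(k)`. -/
def Hom (k : Type*) [CommRing k] (a b : ℕ) : Type _ :=
  Quot (fun f g : Pre k a b => Rel f g)

section Operations

variable {k : Type*} [CommRing k]

/-- The identity of the object `n`. -/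
def Hom.id (k : Type*) [CommRing k] (n : ℕ) : Hom k n n := Quot.mk _ (Pre.id n)

/-- The generator `cup : 0 → 2`. -/
def Hom.cup (k : Type*) [CommRing k] : Hom k 0 2 := Quot.mk _ Pre.cup

/-- The generator `cap : 2 → 0`. -/
def Hom.cap (k : Type*) [CommRing k] : Hom k 2 0 := Quot.mk _ Pre.cap

/-- Composition `g ∘ f`. -/
def Hom.comp {a b c : ℕ} (g : Hom k b c) (f : Hom k a b) : Hom k a c :=
  Quot.map₂ Pre.comp (fun g _ _ h => Rel.comp_congr (Rel.refl g) h)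
    (fun _ _ f h => Rel.comp_congr h (Rel.refl f)) g f

/-- Tensor product of morphisms. -/
def Hom.tensor {a b c d : ℕ} (f : Hom k a b) (g : Hom k c d) : Hom k (a + c) (b + d) :=
  Quot.map₂ Pre.tensor (fun g _ _ h => Rel.tensor_congr (Rel.refl g) h)
    (fun _ _ f h => Rel.tensor_congr h (Rel.refl f)) f g

/-- Transport along equalities of objects (for instance `(a + b) + c = a + (b + c)`). -/
def Hom.cast {a b a' b' : ℕ} (ha : a = a') (hb : b = b') (f : Hom k a b) : Hom k a' b' :=
  ha ▸ hb ▸ f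

instance {a b : ℕ} : Zero (Hom k a b) := ⟨Quot.mk _ (Pre.zero a b)⟩

instance {a b : ℕ} : Add (Hom k a b) :=
  ⟨Quot.map₂ Pre.add (fun g _ _ h => Rel.add_congr (Rel.refl g) h)
    (fun _ _ f h => Rel.add_congr h (Rel.refl f))⟩

instance {a b : ℕ} : SMul k (Hom k a b) :=
  ⟨fun r => Quot.map (Pre.smul r) (fun _ _ h => Rel.smul_congr r h)⟩

instance {a b : ℕ} : AddCommMonoid (Hom k a b) where
  add_assoc := by
    rintro ⟨f⟩ ⟨g⟩ ⟨h⟩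
    exact Quot.sound (Rel.add_assoc f g h)
  zero_add := by
    rintro ⟨f⟩
    exact Quot.sound (Rel.zero_add f)
  add_zero := by
    rintro ⟨f⟩
    exact Quot.sound ((Rel.add_comm _ _).trans (Rel.zero_add f))
  add_comm := by
    rintro ⟨f⟩ ⟨g⟩
    exact Quot.sound (Rel.add_comm f g)
  nsmul := nsmulRec

instance {a b : ℕ} : Module k (Hom k a b) where
  one_smul := by
    rintro ⟨f⟩
    exact Quot.sound (Rel.one_smul f)
  mul_smul := by
    rintro r s ⟨f⟩
    exact Quot.sound (Rel.mul_smul r s f)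
  smul_add := by
    rintro r ⟨f⟩ ⟨g⟩
    exact Quot.sound (Rel.smul_add r f g)
  add_smul := by
    rintro r s ⟨f⟩
    exact Quot.sound (Rel.add_smul r s f)
  zero_smul := by
    rintro ⟨f⟩
    exact Quot.sound (Rel.zero_smul f)
  smul_zero := by
    intro r
    refine Quot.sound ?_
    have h0 := Rel.zero_smul (Pre.zero a b : Pre k a b)
    refine (Rel.smul_congr r h0.symm).trans ((Rel.mul_smul r 0 _).symm.trans ?_)
    rw [mul_zero]
    exact h0

/-- Turning a formal expression upside down. -/
def Pre.bar {k : Type*} : ∀ {a b : ℕ}, Pre k a b → Pre k b a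
  | _, _, .cup => .cap
  | _, _, .cap => .cup
  | _, _, .id n => .id n
  | _, _, .comp g f => .comp f.bar g.bar
  | _, _, .tensor f g => .tensor f.bar g.bar
  | _, _, .zero a b => .zero b a
  | _, _, .add f g => .add f.bar g.bar
  | _, _, .smul r f => .smul r f.bar

theorem Rel.bar {a b a' b' : ℕ} {f : Pre k a b} {f' : Pre k a' b'} (h : Rel f f') :
    Rel f.bar f'.bar := by
  induction h with
  | refl f => exact .refl _
  | symm _ ih => exact ih.symm
  | trans _ _ ih ih' => exact ih.trans ih'
  | comp_congr _ _ ih ih' => exact .comp_congr ih' ih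
  | tensor_congr _ _ ih ih' => exact .tensor_congr ih ih'
  | add_congr _ _ ih ih' => exact .add_congr ih ih'
  | smul_congr r _ ih => exact .smul_congr r ih
  | id_comp f => exact .comp_id _
  | comp_id f => exact .id_comp _
  | comp_assoc h g f => exact (Rel.comp_assoc _ _ _).symm
  | tensor_id a b => exact .tensor_id _ _
  | interchange g f g' f' => exact .interchange _ _ _ _
  | tensor_assoc f g h => exact .tensor_assoc _ _ _
  | unit_tensor f => exact .unit_tensor _
  | tensor_unit f => exact .tensor_unit _
  | add_assoc f g h => exact .add_assoc _ _ _
  | add_comm f g => exact .add_comm _ _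
  | zero_add f => exact .zero_add _
  | one_smul f => exact .one_smul _
  | mul_smul r s f => exact .mul_smul _ _ _
  | smul_add r f g => exact .smul_add _ _ _
  | add_smul r s f => exact .add_smul _ _ _
  | zero_smul f => exact .zero_smul _
  | comp_add g f f' => exact .add_comp _ _ _
  | add_comp g g' f => exact .comp_add _ _ _
  | comp_smul r g f => exact .smul_comp _ _ _
  | smul_comp r g f => exact .comp_smul _ _ _
  | tensor_add g f f' => exact .tensor_add _ _ _
  | add_tensor g g' f => exact .add_tensor _ _ _
  | tensor_smul r g f => exact .tensor_smul _ _ _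
  | smul_tensor r g f => exact .smul_tensor _ _ _
  | zigzag_left => exact .zigzag_right
  | zigzag_right => exact .zigzag_left
  | circle => exact .circle

/-- The contravariant `k`-linear monoidal functor `x ↦ x̄` exchanging `cup` and `cap`. -/
def Hom.bar {a b : ℕ} (f : Hom k a b) : Hom k b a :=
  Quot.map Pre.bar (fun _ _ h => h.bar) f

end Operations

infixr:80 " ⊚ " => Hom.comp
infixl:85 " ⊠ " => Hom.tensor

/-! ## Cap diagrams -/

/-- A cap diagram on `n` strands, i.e. an element of `𝒟ₙ`, given by its caps: `partner i = j`
if a cap joins `i` and `j`, and `partner i = i` if `i` is a through strand. Below a cap there are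
only strands that are capped off below the same cap: caps do not cross each other or
a through strand. -/
@[ext]
structure CapDiagram (n : ℕ) where
  partner : Fin n → Fin n
  partner_partner : ∀ i, partner (partner i) = i
  nested : ∀ i j, i < j → j < partner i → i < partner j ∧ partner j < partner i ∧ partner j ≠ j

namespace CapDiagram

noncomputable instance (n : ℕ) : Fintype (CapDiagram n) :=
  Fintype.ofInjective CapDiagram.partner (fun _ _ h => CapDiagram.ext h)

/-- The number `th(x)` of through strands. -/
def th {n : ℕ} (x : CapDiagram n) : ℕ :=
  (Finset.univ.filter (fun i => x.partner i = i)).card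

/-- The left-right reflection `ϑ(x)`. -/
def reflect {n : ℕ} (x : CapDiagram n) : CapDiagram n where
  partner i := (x.partner i.rev).rev
  partner_partner i := by simp [x.partner_partner]
  nested i j hij hj := by
    have h1 : x.partner i.rev < j.rev := Fin.lt_rev_iff.mp (by simpa using hj)
    have h2 : j.rev < i.rev := Fin.rev_lt_rev.mpr hij
    have := x.nested (x.partner i.rev) j.rev h1 (by rw [x.partner_partner]; exact h2)
    rw [x.partner_partner] at this
    refine ⟨?_, ?_, ?_⟩
    · exact Fin.lt_rev_iff.mpr this.2.1
    · exact Fin.rev_lt_rev.mpr this.1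
    · intro h
      exact this.2.2 (by rw [← Fin.rev_rev (x.partner j.rev), h])

variable {m n : ℕ}

theorem natAdd_lt_iff {i j : Fin n} : Fin.natAdd m i < Fin.natAdd m j ↔ i < j := by
  simp only [Fin.lt_def, Fin.val_natAdd]
  omega

/-- `x_{≤ m}`: delete the last `n` strands; half-caps become through strands. -/
def left (x : CapDiagram (m + n)) : CapDiagram m where
  partner i := Fin.addCases (fun i' => i') (fun _ => i) (x.partner (Fin.castAdd n i))
  partner_partner i := by
    have hi := x.partner_partner (Fin.castAdd n i)
    induction h : x.partner (Fin.castAdd n i) using Fin.addCases with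
    | left j => rw [h] at hi; simp [hi]
    | right j => simp [h]
  nested i j hij hj := by
    induction h : x.partner (Fin.castAdd n i) using Fin.addCases with
    | left i' =>
      rw [h] at hj
      simp only [Fin.addCases_left] at hj ⊢
      have := x.nested (Fin.castAdd n i) (Fin.castAdd n j) hij (by rw [h]; exact hj)
      rw [h] at this
      induction h' : x.partner (Fin.castAdd n j) using Fin.addCases with
      | left j' =>
        rw [h'] at this
        simp only [Fin.addCases_left]
        refine ⟨this.1, this.2.1, fun e => this.2.2 (by rw [e])⟩
      | right j' =>
        rw [h'] at this
        have h2 := this.2.1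
        simp only [Fin.lt_def, Fin.val_natAdd, Fin.val_castAdd] at h2
        omega
    | right i' =>
      rw [h] at hj
      simp only [Fin.addCases_right] at hj
      exact absurd (hij.trans hj) (lt_irrefl _)

/-- `x_{> m}`: delete the first `m` strands; half-caps become through strands. -/
def right (x : CapDiagram (m + n)) : CapDiagram n where
  partner i := Fin.addCases (fun _ => i) (fun i' => i') (x.partner (Fin.natAdd m i))
  partner_partner i := by
    have hi := x.partner_partner (Fin.natAdd m i)
    induction h : x.partner (Fin.natAdd m i) using Fin.addCases with
    | left j => simp [h]
    | right j => rw [h] at hi; simp [hi]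
  nested i j hij hj := by
    have hij' : Fin.natAdd m i < Fin.natAdd m j :=
       natAdd_lt_iff.mpr hij
    induction h : x.partner (Fin.natAdd m i) using Fin.addCases with
    | right i' =>
      rw [h] at hj
      simp only [Fin.addCases_right] at hj ⊢
      have := x.nested (Fin.natAdd m i) (Fin.natAdd m j) hij'
        (by rw [h]; exact natAdd_lt_iff.mpr hj)
      rw [h] at this
      induction h' : x.partner (Fin.natAdd m j) using Fin.addCases with
      | right j' =>
        rw [h'] at this
        simp only [Fin.addCases_right]
        refine ⟨?_, ?_, fun e => this.2.2 (by rw [e])⟩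
        · exact natAdd_lt_iff.mp this.1
        · exact natAdd_lt_iff.mp this.2.1
      | left j' =>
        rw [h'] at this
        have h2 := this.1
        simp only [Fin.lt_def, Fin.val_natAdd, Fin.val_castAdd] at h2
        omega
    | left i' =>
      rw [h] at hj
      simp only [Fin.addCases_left] at hj
      exact absurd (hij.trans hj) (lt_irrefl _)

/-- Placing two cap diagrams side by side. -/
def concat (y : CapDiagram m) (y' : CapDiagram n) : CapDiagram (m + n) where
  partner := Fin.addCases (fun i => Fin.castAdd n (y.partner i))
    (fun i => Fin.natAdd m (y'.partner i))
  partner_partner i := by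
    induction i using Fin.addCases with
    | left i => simp [y.partner_partner]
    | right i => simp [y'.partner_partner]
  nested i j hij hj := by
    induction i using Fin.addCases with
    | left i =>
      induction j using Fin.addCases with
      | left j =>
        simp only [Fin.addCases_left] at hj ⊢
        have := y.nested i j hij hj
        exact ⟨this.1, this.2.1, fun e => this.2.2 (by simpa [Fin.ext_iff] using e)⟩
      | right j =>
        simp only [Fin.addCases_left, Fin.lt_def, Fin.val_natAdd, Fin.val_castAdd] at hj
        omega
    | right i =>
      induction j using Fin.addCases with
      | left j =>
        simp only [Fin.lt_def, Fin.val_natAdd, Fin.val_castAdd] at hij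
        omega
      | right j =>
        simp only [Fin.addCases_right, Fin.lt_def, Fin.val_natAdd] at hij hj ⊢
        have := y'.nested i j (by rw [Fin.lt_def]; omega) (by rw [Fin.lt_def]; omega)
        simp only [Fin.lt_def] at this
        exact ⟨by omega, by omega, fun e => this.2.2 (by simpa [Fin.ext_iff] using e)⟩

/-- Joining two through strands `a < b` that have no through strand between them by a cap. -/
def join (x : CapDiagram n) (a b : Fin n) (hab : a < b) (ha : x.partner a = a)
    (hb : x.partner b = b) (h : ∀ j, a < j → j < b → x.partner j ≠ j) : CapDiagram n where
  partner i := if i = a then b else if i = b then a else x.partner i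
  partner_partner i := by
    by_cases h1 : i = a
    · simp [h1, hab.ne']
    · by_cases h2 : i = b
      · simp [h2, hab.ne']
      · have e1 : x.partner i ≠ a := fun e => h1 (by rw [← x.partner_partner i, e, ha])
        have e2 : x.partner i ≠ b := fun e => h2 (by rw [← x.partner_partner i, e, hb])
        simp [h1, h2, e1, e2, x.partner_partner]
  nested i j hij hj := by
    have key : ∀ i, x.partner i ≠ i → i ≠ a ∧ i ≠ b ∧ x.partner i ≠ a ∧ x.partner i ≠ b := by
      intro i hi
      refine ⟨fun e => hi (by rw [e, ha]), fun e => hi (by rw [e, hb]), fun e => ?_, fun e => ?_⟩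
      · have := x.partner_partner i
        rw [e, ha] at this
        exact hi (by rw [e, this])
      · have := x.partner_partner i
        rw [e, hb] at this
        exact hi (by rw [e, this])
    by_cases h1 : i = a
    · subst h1
      simp only [if_true] at hj ⊢
      have hjj := h j hij hj
      obtain ⟨k1, k2, k3, k4⟩ := key j hjj
      simp only [k1, k2, if_false]
      refine ⟨?_, ?_, hjj⟩
      · by_contra hlt
        have hlt' : x.partner j < i := lt_of_le_of_ne (not_lt.mp hlt) k3
        have := x.nested (x.partner j) i hlt' (by rw [x.partner_partner]; exact hij)
        exact this.2.2 ha
      · by_contra hlt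
        have hlt' : b < x.partner j := lt_of_le_of_ne (not_lt.mp hlt) (Ne.symm k4)
        exact (x.nested j b hj hlt').2.2 hb
    · by_cases h2 : i = b
      · subst h2
        simp only [hab.ne', if_false, if_true] at hj
        exact absurd (hij.trans (hj.trans hab)) (lt_irrefl _)
      · simp only [h1, h2, if_false] at hj ⊢
        have := x.nested i j hij hj
        obtain ⟨k1, k2, -, -⟩ := key j this.2.2
        simp only [k1, k2, if_false]
        exact this

theorem card_filter_fin_add (p : Fin (m + n) → Prop) [DecidablePred p] :
    (Finset.univ.filter p).card = (Finset.univ.filter (fun i : Fin m => p (Fin.castAdd n i))).card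
      + (Finset.univ.filter (fun i : Fin n => p (Fin.natAdd m i))).card := by
  simp only [Finset.card_filter, Fin.sum_univ_add]

/-- Through strands among the first `m` strands. -/
def thruL (x : CapDiagram (m + n)) : Finset (Fin m) :=
  Finset.univ.filter (fun i => x.partner (Fin.castAdd n i) = Fin.castAdd n i)

/-- Through strands among the last `n` strands. -/
def thruR (x : CapDiagram (m + n)) : Finset (Fin n) :=
  Finset.univ.filter (fun i => x.partner (Fin.natAdd m i) = Fin.natAdd m i)

/-- Join the rightmost through strand among the first `m` strands to the leftmost through strand
among the last `n` strands by a cap (if both exist). -/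
def hookOnce (x : CapDiagram (m + n)) : CapDiagram (m + n) :=
  if h : x.thruL.Nonempty ∧ x.thruR.Nonempty then
    x.join (Fin.castAdd n (x.thruL.max' h.1)) (Fin.natAdd m (x.thruR.min' h.2))
      (by
        have := (x.thruL.max' h.1).isLt
        simp only [Fin.lt_def, Fin.val_natAdd, Fin.val_castAdd]
        omega)
      (Finset.mem_filter.mp (x.thruL.max'_mem h.1)).2
      (Finset.mem_filter.mp (x.thruR.min'_mem h.2)).2
      (by
        intro j h1 h2 hj
        induction j using Fin.addCases with
        | left j =>
          have := x.thruL.le_max' j (Finset.mem_filter.mpr ⟨Finset.mem_univ _, hj⟩)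
          simp only [Fin.lt_def, Fin.le_def, Fin.val_castAdd] at this h1
          omega
        | right j =>
          have := x.thruR.min'_le j (Finset.mem_filter.mpr ⟨Finset.mem_univ _, hj⟩)
          simp only [Fin.lt_def, Fin.le_def, Fin.val_natAdd] at this h2
          omega)
  else x

/-- `y ⊙ₗ y'`: put `y` and `y'` side by side and, `l` times, join the rightmost through strand
of `y` to the leftmost through strand of `y'`. -/
def hook (l : ℕ) (y : CapDiagram m) (y' : CapDiagram n) : CapDiagram (m + n) :=
  hookOnce^[l] (y.concat y')

/-- `hk_m(x)`: the number `l` with `th(x) + 2l = th(x_{≤ m}) + th(x_{> m})`,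
see `th_add_two_mul_hk`. -/
def hk (x : CapDiagram (m + n)) : ℕ := (x.left.th + x.right.th - x.th) / 2

theorem th_eq (x : CapDiagram (m + n)) : x.th = x.thruL.card + x.thruR.card := by
  rw [th, card_filter_fin_add]; rfl

theorem left_fixed_iff (x : CapDiagram (m + n)) (i : Fin m) : x.left.partner i = i ↔
    x.partner (Fin.castAdd n i) = Fin.castAdd n i ∨
      ∃ j, x.partner (Fin.castAdd n i) = Fin.natAdd m j := by
  have hcn : ∀ (i : Fin m) (j : Fin n), Fin.castAdd n i ≠ Fin.natAdd m j := by
    intro i j e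
    rw [Fin.ext_iff] at e
    simp only [Fin.val_castAdd, Fin.val_natAdd] at e
    omega
  change Fin.addCases (fun i' => i') (fun _ => i) (x.partner (Fin.castAdd n i)) = i ↔ _
  generalize x.partner (Fin.castAdd n i) = c
  induction c using Fin.addCases with
  | left j => simp [hcn]
  | right j => simp

theorem right_fixed_iff (x : CapDiagram (m + n)) (i : Fin n) : x.right.partner i = i ↔
    x.partner (Fin.natAdd m i) = Fin.natAdd m i ∨
      ∃ j, x.partner (Fin.natAdd m i) = Fin.castAdd n j := by
  have hcn : ∀ (i : Fin m) (j : Fin n), Fin.natAdd m j ≠ Fin.castAdd n i := by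
    intro i j e
    rw [Fin.ext_iff] at e
    simp only [Fin.val_castAdd, Fin.val_natAdd] at e
    omega
  change Fin.addCases (fun _ => i) (fun i' => i') (x.partner (Fin.natAdd m i)) = i ↔ _
  generalize x.partner (Fin.natAdd m i) = c
  induction c using Fin.addCases with
  | left j => simp
  | right j => simp [hcn]

theorem th_left (x : CapDiagram (m + n)) : x.left.th = x.thruL.card +
    (Finset.univ.filter (fun i : Fin m => ∃ j, x.partner (Fin.castAdd n i) = Fin.natAdd m j)).card := by
  rw [th, thruL, ← Finset.card_union_of_disjoint]
  · congr 1
    ext i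
    simp only [left_fixed_iff, Finset.mem_filter, Finset.mem_univ, true_and, Finset.mem_union]
  · rw [Finset.disjoint_filter]
    rintro i - h ⟨j, hj⟩
    rw [h, Fin.ext_iff] at hj
    simp at hj
    omega

theorem th_right (x : CapDiagram (m + n)) : x.right.th = x.thruR.card +
    (Finset.univ.filter (fun i : Fin n => ∃ j, x.partner (Fin.natAdd m i) = Fin.castAdd n j)).card := by
  rw [th, thruR, ← Finset.card_union_of_disjoint]
  · congr 1
    ext i
    simp only [right_fixed_iff, Finset.mem_filter, Finset.mem_univ, true_and, Finset.mem_union]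
  · rw [Finset.disjoint_filter]
    rintro i - h ⟨j, hj⟩
    rw [h, Fin.ext_iff] at hj
    simp at hj
    omega

theorem card_cross (x : CapDiagram (m + n)) :
    (Finset.univ.filter (fun i : Fin m => ∃ j, x.partner (Fin.castAdd n i) = Fin.natAdd m j)).card
    = (Finset.univ.filter
        (fun i : Fin n => ∃ j, x.partner (Fin.natAdd m i) = Fin.castAdd n j)).card := by
  refine Finset.card_bij' (fun i hi => (Finset.mem_filter.mp hi).2.choose)
    (fun i hi => (Finset.mem_filter.mp hi).2.choose) ?_ ?_ ?_ ?_
  · intro i hi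
    have := (Finset.mem_filter.mp hi).2.choose_spec
    refine Finset.mem_filter.mpr ⟨Finset.mem_univ _, i, ?_⟩
    rw [← this, x.partner_partner]
  · intro i hi
    have := (Finset.mem_filter.mp hi).2.choose_spec
    refine Finset.mem_filter.mpr ⟨Finset.mem_univ _, i, ?_⟩
    rw [← this, x.partner_partner]
  · intro i hi
    generalize_proofs h1 h2
    have := (congrArg x.partner h1.choose_spec).symm.trans (x.partner_partner _)
    exact Fin.castAdd_injective m n (h2.choose_spec.symm.trans this)
  · intro i hi
    generalize_proofs h1 h2
    have := (congrArg x.partner h1.choose_spec).symm.trans (x.partner_partner _)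
    exact Fin.natAdd_injective n m (h2.choose_spec.symm.trans this)

theorem th_add_two_mul_hk (x : CapDiagram (m + n)) :
    x.th + 2 * x.hk = x.left.th + x.right.th := by
  have h1 := x.th_left
  have h2 := x.th_right
  have h3 := x.card_cross
  have h4 := x.th_eq
  unfold hk
  omega

theorem thruL_concat (y : CapDiagram m) (y' : CapDiagram n) : (y.concat y').thruL.card = y.th := by
  simp [thruL, concat, th, Fin.ext_iff]

theorem thruR_concat (y : CapDiagram m) (y' : CapDiagram n) : (y.concat y').thruR.card = y'.th := by
  simp [thruR, concat, th, Fin.ext_iff]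

theorem card_hookOnce (x : CapDiagram (m + n)) (hl : 0 < x.thruL.card) (hr : 0 < x.thruR.card) :
    x.hookOnce.thruL.card + 1 = x.thruL.card ∧ x.hookOnce.thruR.card + 1 = x.thruR.card := by
  have h : x.thruL.Nonempty ∧ x.thruR.Nonempty :=
    ⟨Finset.card_pos.mp hl, Finset.card_pos.mp hr⟩
  have hcn : ∀ (i : Fin m) (j : Fin n), Fin.castAdd n i ≠ Fin.natAdd m j := by
    intro i j e
    rw [Fin.ext_iff] at e
    simp at e
    omega
  constructor
  · have : x.hookOnce.thruL = x.thruL.erase (x.thruL.max' h.1) := by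
      ext i
      rw [thruL, hookOnce, dif_pos h]
      simp only [join, Finset.mem_filter, Finset.mem_univ, true_and, Finset.mem_erase, hcn, if_false]
      by_cases e : i = x.thruL.max' h.1
      · simp [← e, (hcn _ _).symm]
      · have e' : Fin.castAdd n i ≠ Fin.castAdd n (x.thruL.max' h.1) :=
          fun e' => e (Fin.castAdd_injective m n e')
        simp only [e', if_false]
        exact ⟨fun hx => ⟨e, Finset.mem_filter.mpr ⟨Finset.mem_univ _, hx⟩⟩,
          fun hx => (Finset.mem_filter.mp hx.2).2⟩
    rw [this, Finset.card_erase_add_one (x.thruL.max'_mem h.1)]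
  · have : x.hookOnce.thruR = x.thruR.erase (x.thruR.min' h.2) := by
      ext i
      rw [thruR, hookOnce, dif_pos h]
      simp only [join, Finset.mem_filter, Finset.mem_univ, true_and, Finset.mem_erase,
        (hcn _ _).symm, if_false]
      by_cases e : i = x.thruR.min' h.2
      · simp [← e, hcn]
      · have e' : Fin.natAdd m i ≠ Fin.natAdd m (x.thruR.min' h.2) :=
          fun e' => e (Fin.natAdd_injective n m e')
        simp only [e', if_false]
        exact ⟨fun hx => ⟨e, Finset.mem_filter.mpr ⟨Finset.mem_univ _, hx⟩⟩,
          fun hx => (Finset.mem_filter.mp hx.2).2⟩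
    rw [this, Finset.card_erase_add_one (x.thruR.min'_mem h.2)]

theorem th_iterate_hookOnce (l : ℕ) (x : CapDiagram (m + n)) (hl : l ≤ x.thruL.card)
    (hr : l ≤ x.thruR.card) : (hookOnce^[l] x).th + 2 * l = x.th := by
  induction l generalizing x with
  | zero => simp
  | succ l ih =>
    have h := x.card_hookOnce (by omega) (by omega)
    have := ih x.hookOnce (by omega) (by omega)
    rw [Function.iterate_succ_apply]
    rw [th_eq x.hookOnce] at this
    rw [th_eq x]
    omega

theorem th_hook (l : ℕ) (y : CapDiagram m) (y' : CapDiagram n) (hl : l ≤ y.th) (hr : l ≤ y'.th) :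
    (hook l y y').th + 2 * l = y.th + y'.th := by
  have := th_iterate_hookOnce l (y.concat y') (by rwa [thruL_concat]) (by rwa [thruR_concat])
  rwa [th_eq (y.concat y'), thruL_concat, thruR_concat] at this

/-- `κ_{m,n}(x) = x_{> m} ⊙ₗ x_{≤ m}` with `l = hk_m(x)`. -/
def kappa (m n : ℕ) (x : CapDiagram (m + n)) : CapDiagram (n + m) :=
  hook x.hk x.right x.left

theorem th_kappa (x : CapDiagram (m + n)) : (kappa m n x).th = x.th := by
  have h0 := x.th_add_two_mul_hk
  have h1 := x.th_left
  have h2 := x.th_right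
  have h3 := x.card_cross
  have h4 := x.th_eq
  have := th_hook x.hk x.right x.left (by omega) (by omega)
  unfold kappa
  omega

theorem th_reflect (x : CapDiagram n) : x.reflect.th = x.th := by
  have key : ∀ i, x.reflect.partner i = i ↔ x.partner i.rev = i.rev := fun i => by
    change (x.partner i.rev).rev = i ↔ _
    rw [Fin.rev_eq_iff]
  refine Finset.card_bij' (fun i _ => i.rev) (fun i _ => i.rev) ?_ ?_ ?_ ?_
  · intro i hi
    exact Finset.mem_filter.mpr ⟨Finset.mem_univ _, (key i).mp (Finset.mem_filter.mp hi).2⟩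
  · intro i hi
    refine Finset.mem_filter.mpr ⟨Finset.mem_univ _, (key _).mpr ?_⟩
    rw [Fin.rev_rev]
    exact (Finset.mem_filter.mp hi).2
  · simp
  · simp

theorem th_left_of_last_fixed (x : CapDiagram (n + 1))
    (h : x.partner (Fin.last n) = Fin.last n) : x.left.th + 1 = x.th := by
  have hl : (Fin.natAdd n (0 : Fin 1)) = Fin.last n := by ext; simp
  have h1 := x.th_left
  have h3 := x.card_cross
  have h4 := x.th_eq
  have e1 : x.thruR.card = 1 := by
    rw [thruR, Finset.card_filter, Fin.sum_univ_one, hl]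
    simp [h]
  have e2 : (Finset.univ.filter
      (fun i : Fin 1 => ∃ j, x.partner (Fin.natAdd n i) = Fin.castAdd 1 j)).card = 0 := by
    rw [Finset.card_eq_zero, Finset.filter_eq_empty_iff]
    rintro i - ⟨j, hj⟩
    rw [Subsingleton.elim i 0, hl, h, Fin.ext_iff] at hj
    simp at hj
    omega
  omega

theorem th_left_of_last_capped (x : CapDiagram (n + 1))
    (h : x.partner (Fin.last n) ≠ Fin.last n) : x.left.th = x.th + 1 := by
  have hl : (Fin.natAdd n (0 : Fin 1)) = Fin.last n := by ext; simp
  have h1 := x.th_left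
  have h3 := x.card_cross
  have h4 := x.th_eq
  have e1 : x.thruR.card = 0 := by
    rw [thruR, Finset.card_filter, Fin.sum_univ_one, hl]
    simp [h]
  have e2 : (Finset.univ.filter
      (fun i : Fin 1 => ∃ j, x.partner (Fin.natAdd n i) = Fin.castAdd 1 j)).card = 1 := by
    have : ∃ j, x.partner (Fin.last n) = Fin.castAdd 1 j := by
      induction h' : x.partner (Fin.last n) using Fin.addCases with
      | left j => exact ⟨j, rfl⟩
      | right j => rw [Subsingleton.elim j 0, hl] at h'; exact absurd h' h
    rw [Finset.card_filter, Fin.sum_univ_one, hl]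
    simp [this]
  omega

end CapDiagram

/-! ## Cap diagrams as morphisms, Jones-Wenzl projectors, the commutor -/

section Commutor

variable (k : Type*) [CommRing k]

/-- The morphism `n → th(x)` depicted by the cap diagram `x`. The last strand is either a through
strand, or is capped with the rightmost through strand of the diagram formed by the preceding
strands. -/
def CapDiagram.toHom : ∀ {n : ℕ} (x : CapDiagram n), Hom k n x.th
  | 0, x => (Hom.id k 0).cast rfl (by simp [CapDiagram.th])
  | n + 1, x =>
    if h : x.partner (Fin.last n) = Fin.last n then
      (CapDiagram.toHom (CapDiagram.left (m := n) (n := 1) x) ⊠ Hom.id k 1).cast rfl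
        (CapDiagram.th_left_of_last_fixed x h)
    else
      (Hom.id k x.th ⊠ Hom.cap k) ⊚
        (CapDiagram.toHom (CapDiagram.left (m := n) (n := 1) x) ⊠ Hom.id k 1).cast rfl
          (congrArg (· + 1) (CapDiagram.th_left_of_last_capped x h))

variable {k}

/-- Apt subsets (with positions numbered from `0`): the last position is not in `I`, and `I` does
not contain two consecutive positions. -/
def Apt {n : ℕ} (I : Finset (Fin n)) : Prop :=
  ∀ i ∈ I, (i : ℕ) + 1 < n ∧ ∀ j ∈ I, (j : ℕ) ≠ i + 1

/-- The cap diagram `cap_{I,n}` with caps joining `i` and `i + 1` for `i ∈ I`. -/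
def capOfApt {n : ℕ} (I : Finset (Fin n)) (hI : Apt I) : CapDiagram n where
  partner i :=
    if h : i ∈ I then ⟨i + 1, (hI i h).1⟩
    else if h : ∃ j ∈ I, (i : ℕ) = j + 1 then ⟨i - 1, by omega⟩
    else i
  partner_partner i := by
    by_cases h1 : i ∈ I
    · have h2 : (⟨i + 1, (hI i h1).1⟩ : Fin n) ∉ I := fun h => (hI i h1).2 _ h rfl
      have h3 : ∃ j ∈ I, ((⟨i + 1, (hI i h1).1⟩ : Fin n) : ℕ) = j + 1 := ⟨i, h1, rfl⟩
      rw [dif_pos h1, dif_neg h2, dif_pos h3]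
      rfl
    · by_cases h2 : ∃ j ∈ I, (i : ℕ) = j + 1
      · have h2' := h2
        obtain ⟨j, hj, e⟩ := h2'
        have h3 : (⟨i - 1, by omega⟩ : Fin n) = j := by ext; simp only; omega
        rw [dif_neg h1, dif_pos h2, h3, dif_pos hj]
        ext
        exact e.symm
      · rw [dif_neg h1, dif_neg h2, dif_neg h1, dif_neg h2]
  nested i j hij hj := by
    exfalso
    rw [Fin.lt_def] at hij
    split_ifs at hj <;> rw [Fin.lt_def] at hj <;> (try simp only at hj) <;> omega

open Classical in
/-- The Jones-Wenzl projector `j_n`. -/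
noncomputable def jonesWenzl (k : Type*) [CommRing k] (n : ℕ) : Hom k n n :=
  ∑ I : {I : Finset (Fin n) // Apt I}, (-1 : k) ^ I.1.card •
    (((capOfApt I.1 I.2).toHom k).bar ⊚ (capOfApt I.1 I.2).toHom k)

/-- The morphism `ȳ ∘ j_{th(x)} ∘ x` for cap diagrams `x`, `y` with equally many
through strands. -/
noncomputable def maxSummand (k : Type*) [CommRing k] {m n : ℕ} (y : CapDiagram n)
    (x : CapDiagram m) (h : y.th = x.th) : Hom k m n :=
  (y.toHom k).bar.cast h rfl ⊚ jonesWenzl k x.th ⊚ x.toHom k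

/-- The commutor `σ_{m,n} : m ⊗ n → n ⊗ m`, the sum over `x ∈ 𝒟_{m+n}` of
`τ_{m,n}(x)`, the composite of `x`, `j_{th(x)}` and the upside-down `κ_{m,n}(x)`. -/
noncomputable def commutor (k : Type*) [CommRing k] (m n : ℕ) : Hom k (m + n) (n + m) :=
  ∑ x : CapDiagram (m + n), maxSummand k (CapDiagram.kappa m n x) x (CapDiagram.th_kappa x)

/-- `σ_{p,r,q}` on the `n`-fold tensor power of the object `1`: the commutor of the factors
`p, …, r` with the factors `r + 1, …, q`, tensored with identities. -/
noncomputable def commutorAt (k : Type*) [CommRing k] (n p r q : ℕ)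
    (h : 1 ≤ p ∧ p ≤ r ∧ r < q ∧ q ≤ n) : Hom k n n :=
  (Hom.id k (p - 1) ⊠ commutor k (r - p + 1) (q - r) ⊠ Hom.id k (n - q)).cast
    (by omega) (by omega)

/-- The interval-reversal morphism `s_{p,q}` on the `n`-fold tensor power of the object `1`:
`s_{p,p+1} = σ_{p,p,p+1}` and `s_{p,q} = σ_{p,p,q} ∘ s_{p+1,q}`. -/
noncomputable def intervalReversal (k : Type*) [CommRing k] (n p q : ℕ)
    (h : 1 ≤ p ∧ p < q ∧ q ≤ n) : Hom k n n :=
  if hq : q = p + 1 then commutorAt k n p p q (by omega)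
  else commutorAt k n p p q (by omega) ⊚ intervalReversal k n (p + 1) q (by omega)
termination_by q - p

end Commutor

end CrysTL

namespace CrysTL

/-! For cap diagrams `x`, `y` with `t` through strands write `c(y, x) = ȳ ∘ j_t ∘ x`. These
morphisms multiply like matrix units: `c(z, y') ∘ c(y, x)` is `c(z, x)` if `y' = y` and zero
otherwise (`pathUnit_comp_self`, `pathUnit_comp_of_ne`). This reduces to `j_s ∘ y' ∘ ȳ ∘ j_t` being
`j_t` or zero (`Path.jonesWenzl_toHom_self`, `Path.jonesWenzl_toHom_of_ne`), which follows by
removing the last strand of both diagrams. The inputs are the recursion `j_{n+2} = j_{n+1} ⊗ 1 - cup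
∘ j_n ∘ cap` at the right end, the idempotence of `j_n`, and the vanishing of `j_n` against a cup or
cap at the right end.

So a sum of `c(f(x), x)` over all `x` acts on matrix units by `f` on the upper diagram. The commutor
with `m = 1` is such a sum with `f = κ_{1,n}`, and the claimed reversal is one with `f = ϑ`. By the
mirror form of the recursion (`addLeft_jonesWenzl`), `1 ⊗ c(y, x) = c(|y, |x) + c(∩y, ∩x)`, where
`|` adds a through strand on the left and `∩` a strand capped with the leftmost through strand; the
second term is absent when `t = 0`. Since `κ_{1,n}` moves the first strand to the far right, keeping
its type, `κ(|ϑ(x)) = ϑ(|x)` and `κ(∩ϑ(x)) = ϑ(∩x)`. Each diagram on `n + 1` strands is exactly one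
of `|x`, `∩x`, so composing the commutor with `1 ⊗` the reversal on `n` strands gives the reversal
on `n + 1` strands (`commutor_comp_addLeft_reversal`). This is the recursion defining `s_{p,q}`.

Diagrams are handled through the inductive type `Path`, which records for each strand in turn
whether it is through or capped on arrival; this determines the diagram (`codeEquiv`). -/

variable {k : Type*} [CommRing k]

/-! ### Transport and the monoidal axioms on the quotient -/

/-- `Rel` may relate expressions whose types are only propositionally equal; once the objects are
identified it is an ordinary quotient relation. The strictness axioms enter through this. -/
theorem Hom.cast_mk {a b a' b' : ℕ} {f : Pre k a b} {f' : Pre k a' b'} (h : Rel f f')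
    (ha : a = a') (hb : b = b') :
    Hom.cast ha hb (Quot.mk _ f : Hom k a b) = (Quot.mk _ f' : Hom k a' b') := by
  subst ha hb
  exact Quot.sound h

@[simp] theorem Hom.cast_rfl {a b : ℕ} (f : Hom k a b) (ha : a = a) (hb : b = b) :
    f.cast ha hb = f := rfl

@[simp] theorem Hom.cast_cast {a b a' b' a'' b'' : ℕ} (f : Hom k a b) (ha : a = a') (hb : b = b')
    (ha' : a' = a'') (hb' : b' = b'') :
    (f.cast ha hb).cast ha' hb' = f.cast (ha.trans ha') (hb.trans hb') := by
  subst ha hb ha' hb'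
  rfl

theorem Hom.cast_comp {a b c a' c' : ℕ} (b' : ℕ) (g : Hom k b c) (f : Hom k a b) (ha : a = a')
    (hb : b = b') (hc : c = c') :
    (g ⊚ f).cast ha hc = g.cast hb hc ⊚ f.cast ha hb := by
  subst ha hb hc
  rfl

theorem Hom.cast_tensor_cast {a b c d a' b' c' d' : ℕ} (f : Hom k a b) (g : Hom k c d)
    (ha : a = a') (hb : b = b') (hc : c = c') (hd : d = d') :
    f.cast ha hb ⊠ g.cast hc hd = (f ⊠ g).cast (by rw [ha, hc]) (by rw [hb, hd]) := by
  subst ha hb hc hd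
  rfl

theorem Hom.cast_add {a b a' b' : ℕ} (f g : Hom k a b) (ha : a = a') (hb : b = b') :
    (f + g).cast ha hb = f.cast ha hb + g.cast ha hb := by
  subst ha hb
  rfl

theorem Hom.cast_smul {a b a' b' : ℕ} (r : k) (f : Hom k a b) (ha : a = a') (hb : b = b') :
    (r • f).cast ha hb = r • f.cast ha hb := by
  subst ha hb
  rfl

theorem Hom.cast_bar {a b a' b' : ℕ} (f : Hom k a b) (ha : a = a') (hb : b = b') :
    (f.cast ha hb).bar = f.bar.cast hb ha := by
  subst ha hb
  rfl

theorem Hom.cast_id {a a' : ℕ} (ha ha' : a = a') : (Hom.id k a).cast ha ha' = Hom.id k a' := by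
  subst ha
  rfl

@[simp] theorem Hom.id_comp {a b : ℕ} (f : Hom k a b) : Hom.id k b ⊚ f = f := by
  obtain ⟨f⟩ := f
  exact Quot.sound (Rel.id_comp f)

@[simp] theorem Hom.comp_id {a b : ℕ} (f : Hom k a b) : f ⊚ Hom.id k a = f := by
  obtain ⟨f⟩ := f
  exact Quot.sound (Rel.comp_id f)

theorem Hom.comp_assoc {a b c d : ℕ} (h : Hom k c d) (g : Hom k b c) (f : Hom k a b) :
    (h ⊚ g) ⊚ f = h ⊚ g ⊚ f := by
  obtain ⟨f⟩ := f
  obtain ⟨g⟩ := g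
  obtain ⟨h⟩ := h
  exact Quot.sound (Rel.comp_assoc h g f)

theorem Hom.tensor_id (a b : ℕ) : Hom.id k a ⊠ Hom.id k b = Hom.id k (a + b) :=
  Quot.sound (Rel.tensor_id a b)

theorem Hom.interchange {a b c a' b' c' : ℕ} (g : Hom k b c) (f : Hom k a b)
    (g' : Hom k b' c') (f' : Hom k a' b') :
    (g ⊚ f) ⊠ (g' ⊚ f') = (g ⊠ g') ⊚ (f ⊠ f') := by
  obtain ⟨f⟩ := f
  obtain ⟨g⟩ := g
  obtain ⟨f'⟩ := f'
  obtain ⟨g'⟩ := g'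
  exact Quot.sound (Rel.interchange g f g' f')

theorem Hom.tensor_assoc {a b c d e e' : ℕ} (f : Hom k a b) (g : Hom k c d) (h : Hom k e e') :
    ((f ⊠ g) ⊠ h).cast (Nat.add_assoc _ _ _) (Nat.add_assoc _ _ _) = f ⊠ (g ⊠ h) := by
  obtain ⟨f⟩ := f
  obtain ⟨g⟩ := g
  obtain ⟨h⟩ := h
  exact Hom.cast_mk (Rel.tensor_assoc f g h) _ _

theorem Hom.unit_tensor {a b : ℕ} (f : Hom k a b) :
    (Hom.id k 0 ⊠ f).cast (Nat.zero_add _) (Nat.zero_add _) = f := by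
  obtain ⟨f⟩ := f
  exact Hom.cast_mk (Rel.unit_tensor f) _ _

theorem Hom.tensor_unit {a b : ℕ} (f : Hom k a b) : f ⊠ Hom.id k 0 = f := by
  obtain ⟨f⟩ := f
  exact Quot.sound (Rel.tensor_unit f)

theorem Hom.comp_add {a b c : ℕ} (g : Hom k b c) (f f' : Hom k a b) :
    g ⊚ (f + f') = g ⊚ f + g ⊚ f' := by
  obtain ⟨f⟩ := f
  obtain ⟨g⟩ := g
  obtain ⟨f'⟩ := f'
  exact Quot.sound (Rel.comp_add g f f')

theorem Hom.add_comp {a b c : ℕ} (g g' : Hom k b c) (f : Hom k a b) :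
    (g + g') ⊚ f = g ⊚ f + g' ⊚ f := by
  obtain ⟨f⟩ := f
  obtain ⟨g⟩ := g
  obtain ⟨g'⟩ := g'
  exact Quot.sound (Rel.add_comp g g' f)

theorem Hom.comp_smul {a b c : ℕ} (r : k) (g : Hom k b c) (f : Hom k a b) :
    g ⊚ (r • f) = r • (g ⊚ f) := by
  obtain ⟨f⟩ := f
  obtain ⟨g⟩ := g
  exact Quot.sound (Rel.comp_smul r g f)

theorem Hom.smul_comp {a b c : ℕ} (r : k) (g : Hom k b c) (f : Hom k a b) :
    (r • g) ⊚ f = r • (g ⊚ f) := by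
  obtain ⟨f⟩ := f
  obtain ⟨g⟩ := g
  exact Quot.sound (Rel.smul_comp r g f)

theorem Hom.tensor_add {a b c d : ℕ} (g : Hom k a b) (f f' : Hom k c d) :
    g ⊠ (f + f') = g ⊠ f + g ⊠ f' := by
  obtain ⟨f⟩ := f
  obtain ⟨g⟩ := g
  obtain ⟨f'⟩ := f'
  exact Quot.sound (Rel.tensor_add g f f')

theorem Hom.add_tensor {a b c d : ℕ} (g g' : Hom k a b) (f : Hom k c d) :
    (g + g') ⊠ f = g ⊠ f + g' ⊠ f := by
  obtain ⟨f⟩ := f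
  obtain ⟨g⟩ := g
  obtain ⟨g'⟩ := g'
  exact Quot.sound (Rel.add_tensor g g' f)

theorem Hom.tensor_smul {a b c d : ℕ} (r : k) (g : Hom k a b) (f : Hom k c d) :
    g ⊠ (r • f) = r • (g ⊠ f) := by
  obtain ⟨f⟩ := f
  obtain ⟨g⟩ := g
  exact Quot.sound (Rel.tensor_smul r g f)

theorem Hom.smul_tensor {a b c d : ℕ} (r : k) (g : Hom k a b) (f : Hom k c d) :
    (r • g) ⊠ f = r • (g ⊠ f) := by
  obtain ⟨f⟩ := f
  obtain ⟨g⟩ := g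
  exact Quot.sound (Rel.smul_tensor r g f)

@[simp] theorem Hom.bar_bar {a b : ℕ} (f : Hom k a b) : f.bar.bar = f := by
  obtain ⟨f⟩ := f
  refine congrArg (Quot.mk _) ?_
  induction f <;> simp_all [Pre.bar]

theorem Hom.bar_comp {a b c : ℕ} (g : Hom k b c) (f : Hom k a b) :
    (g ⊚ f).bar = f.bar ⊚ g.bar := by
  obtain ⟨f⟩ := f
  obtain ⟨g⟩ := g
  rfl

theorem Hom.bar_tensor {a b c d : ℕ} (f : Hom k a b) (g : Hom k c d) :
    (f ⊠ g).bar = f.bar ⊠ g.bar := by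
  obtain ⟨f⟩ := f
  obtain ⟨g⟩ := g
  rfl

theorem Hom.bar_add {a b : ℕ} (f g : Hom k a b) : (f + g).bar = f.bar + g.bar := by
  obtain ⟨f⟩ := f
  obtain ⟨g⟩ := g
  rfl

theorem Hom.bar_smul {a b : ℕ} (r : k) (f : Hom k a b) : (r • f).bar = r • f.bar := by
  obtain ⟨f⟩ := f
  rfl

@[simp] theorem Hom.bar_id (n : ℕ) : (Hom.id k n).bar = Hom.id k n := rfl

/-! ### Linearity, and adding a strand on either side -/

/-- Postcomposition as a linear map. -/
def Hom.postcomp {a b c : ℕ} (g : Hom k b c) : Hom k a b →ₗ[k] Hom k a c where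
  toFun f := g ⊚ f
  map_add' := Hom.comp_add g
  map_smul' r := Hom.comp_smul r g

/-- Precomposition as a linear map. -/
def Hom.precomp {a b c : ℕ} (f : Hom k a b) : Hom k b c →ₗ[k] Hom k a c where
  toFun g := g ⊚ f
  map_add' g g' := Hom.add_comp g g' f
  map_smul' r g := Hom.smul_comp r g f

/-- Turning upside down as a linear map. -/
def Hom.barLinear {a b : ℕ} : Hom k a b →ₗ[k] Hom k b a where
  toFun f := f.bar
  map_add' := Hom.bar_add
  map_smul' := Hom.bar_smul

@[simp] theorem Hom.comp_zero {a b c : ℕ} (g : Hom k b c) : g ⊚ (0 : Hom k a b) = 0 :=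
  map_zero (Hom.postcomp g)

@[simp] theorem Hom.zero_comp {a b c : ℕ} (f : Hom k a b) : (0 : Hom k b c) ⊚ f = 0 :=
  map_zero (Hom.precomp f)

theorem Hom.comp_sum {a b c : ℕ} {ι : Type*} (s : Finset ι) (g : Hom k b c) (f : ι → Hom k a b) :
    g ⊚ (∑ i ∈ s, f i) = ∑ i ∈ s, g ⊚ f i :=
  map_sum (Hom.postcomp g) f s

theorem Hom.sum_comp {a b c : ℕ} {ι : Type*} (s : Finset ι) (g : ι → Hom k b c) (f : Hom k a b) :
    (∑ i ∈ s, g i) ⊚ f = ∑ i ∈ s, g i ⊚ f :=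
  map_sum (Hom.precomp f) g s

/-- Adding a strand on the left. -/
def Hom.addLeft {a b : ℕ} : Hom k a b →ₗ[k] Hom k (a + 1) (b + 1) where
  toFun f := (Hom.id k 1 ⊠ f).cast (Nat.add_comm _ _) (Nat.add_comm _ _)
  map_add' f g := by rw [Hom.tensor_add, Hom.cast_add]
  map_smul' r f := by rw [Hom.tensor_smul, Hom.cast_smul]; rfl

/-- Adding a strand on the right. -/
def Hom.addRight {a b : ℕ} : Hom k a b →ₗ[k] Hom k (a + 1) (b + 1) where
  toFun f := f ⊠ Hom.id k 1
  map_add' f g := Hom.add_tensor f g _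
  map_smul' r f := Hom.smul_tensor r f _

theorem Hom.addLeft_comp {a b c : ℕ} (g : Hom k b c) (f : Hom k a b) :
    Hom.addLeft (g ⊚ f) = Hom.addLeft g ⊚ Hom.addLeft f := by
  change Hom.cast _ _ (Hom.id k 1 ⊠ (g ⊚ f)) = _
  conv_lhs => rw [← Hom.id_comp (Hom.id k 1), Hom.interchange]
  exact Hom.cast_comp _ _ _ _ _ _

theorem Hom.addRight_comp {a b c : ℕ} (g : Hom k b c) (f : Hom k a b) :
    Hom.addRight (g ⊚ f) = Hom.addRight g ⊚ Hom.addRight f := by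
  change (g ⊚ f) ⊠ Hom.id k 1 = _
  conv_lhs => rw [← Hom.id_comp (Hom.id k 1), Hom.interchange]
  rfl

theorem Hom.addLeft_bar {a b : ℕ} (f : Hom k a b) :
    Hom.addLeft f.bar = (Hom.addLeft f).bar := by
  change _ = Hom.bar (Hom.cast _ _ _)
  rw [Hom.cast_bar, Hom.bar_tensor]
  rfl

theorem Hom.addRight_bar {a b : ℕ} (f : Hom k a b) :
    Hom.addRight f.bar = (Hom.addRight f).bar :=
  (Hom.bar_tensor f (Hom.id k 1)).symm

@[simp] theorem Hom.addLeft_id (a : ℕ) : Hom.addLeft (Hom.id k a) = Hom.id k (a + 1) := by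
  change Hom.cast _ _ _ = _
  rw [Hom.tensor_id, Hom.cast_id]

@[simp] theorem Hom.addRight_id (a : ℕ) : Hom.addRight (Hom.id k a) = Hom.id k (a + 1) :=
  Hom.tensor_id a 1

theorem Hom.addLeft_addRight {a b : ℕ} (f : Hom k a b) :
    Hom.addLeft (Hom.addRight f) = Hom.addRight (Hom.addLeft f) := by
  change Hom.cast _ _ (_ ⊠ (_ ⊠ _)) = Hom.cast _ _ _ ⊠ Hom.id k 1
  rw [← Hom.tensor_assoc, Hom.cast_cast, ← Hom.cast_rfl (Hom.id k 1) rfl rfl,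
    Hom.cast_tensor_cast]
  rfl

/-! ### Caps and cups at the outer strands -/

/-- The cap on the two rightmost strands. -/
def capRight (k : Type*) [CommRing k] (t : ℕ) : Hom k (t + 2) t := Hom.id k t ⊠ Hom.cap k

/-- The cap on the two leftmost strands. -/
def capLeft (k : Type*) [CommRing k] (t : ℕ) : Hom k (t + 2) t :=
  (Hom.cap k ⊠ Hom.id k t).cast (Nat.add_comm _ _) (Nat.zero_add _)

/-- The cup on the two rightmost strands. -/
def cupRight (k : Type*) [CommRing k] (t : ℕ) : Hom k t (t + 2) := (capRight k t).bar

/-- The cup on the two leftmost strands. -/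
def cupLeft (k : Type*) [CommRing k] (t : ℕ) : Hom k t (t + 2) := (capLeft k t).bar

theorem Hom.addRight_addRight {a b : ℕ} (f : Hom k a b) :
    Hom.addRight (Hom.addRight f) = f ⊠ Hom.id k 2 := by
  have := Hom.tensor_assoc f (Hom.id k 1) (Hom.id k 1)
  rw [Hom.tensor_id] at this
  exact this

/-- The cap and `f` act on disjoint strands, so the interchange law lets them slide past each other.
-/
theorem capRight_comp {a b : ℕ} (f : Hom k a b) :
    capRight k b ⊚ Hom.addRight (Hom.addRight f) = f ⊚ capRight k a := by
  rw [Hom.addRight_addRight]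
  unfold capRight
  rw [← Hom.interchange]
  conv_rhs => rw [← Hom.tensor_unit f]
  refine Eq.trans ?_ (Hom.interchange f (Hom.id k a) (Hom.id k 0) (Hom.cap k))
  simp

theorem addRight_capLeft (t : ℕ) : Hom.addRight (capLeft k t) = capLeft k (t + 1) := by
  change Hom.cast _ _ _ ⊠ Hom.id k 1 = Hom.cast _ _ _
  rw [← Hom.cast_rfl (Hom.id k 1) rfl rfl, Hom.cast_tensor_cast, ← Hom.tensor_id,
    ← Hom.tensor_assoc, Hom.cast_cast]

theorem addLeft_capRight (t : ℕ) : Hom.addLeft (capRight k t) = capRight k (t + 1) := by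
  have h : Hom.id k (t + 1) = (Hom.id k (1 + t)).cast (Nat.add_comm _ _) (Nat.add_comm _ _) :=
    (Hom.cast_id _ _).symm
  change Hom.cast _ _ _ = Hom.id k (t + 1) ⊠ Hom.cap k
  rw [h, ← Hom.cast_rfl (Hom.cap k) rfl rfl, Hom.cast_tensor_cast, ← Hom.tensor_id]
  change Hom.cast _ _ (_ ⊠ (_ ⊠ _)) = _
  rw [← Hom.tensor_assoc, Hom.cast_cast]

theorem capRight_zero : capRight k 0 = capLeft k 0 := by
  change Hom.id k 0 ⊠ Hom.cap k = Hom.cap k ⊠ Hom.id k 0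
  rw [Hom.tensor_unit]
  exact Hom.unit_tensor (Hom.cap k)

theorem addRight_cupLeft (t : ℕ) : Hom.addRight (cupLeft k t) = cupLeft k (t + 1) := by
  rw [cupLeft, Hom.addRight_bar, addRight_capLeft, cupLeft]

theorem addLeft_cupRight (t : ℕ) : Hom.addLeft (cupRight k t) = cupRight k (t + 1) := by
  rw [cupRight, Hom.addLeft_bar, addLeft_capRight, cupRight]

theorem capRight_comp_capLeft (t : ℕ) :
    capRight k t ⊚ capLeft k (t + 2) = capLeft k t ⊚ capRight k (t + 2) := by
  rw [← addRight_capLeft, ← addRight_capLeft]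
  exact capRight_comp _

theorem cupLeft_comp_cupRight (t : ℕ) :
    cupLeft k (t + 2) ⊚ cupRight k t = cupRight k (t + 2) ⊚ cupLeft k t := by
  have := congrArg Hom.bar (capRight_comp_capLeft (k := k) t)
  rwa [Hom.bar_comp, Hom.bar_comp] at this

theorem capRight_comp_cupRight (t : ℕ) : capRight k t ⊚ cupRight k t = Hom.id k t := by
  have hc : Hom.cap k ⊚ Hom.cup k = Hom.id k 0 := Quot.sound Rel.circle
  rw [cupRight, capRight, Hom.bar_tensor]
  refine (Hom.interchange _ _ _ _).symm.trans ?_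
  change (Hom.id k t ⊚ Hom.id k t) ⊠ (Hom.cap k ⊚ Hom.cup k) = _
  rw [Hom.id_comp, hc]
  exact Hom.tensor_id t 0

/-- This is the left zig-zag relation, carried to wider objects by adding strands on the left. -/
theorem capRight_comp_addRight_cupRight (t : ℕ) :
    capRight k (t + 1) ⊚ Hom.addRight (cupRight k t) = 0 := by
  induction t with
  | zero =>
    have h : (Hom.id k 1 ⊠ Hom.cap k : Hom k 3 1) ⊚ (Hom.cup k ⊠ Hom.id k 1 : Hom k 1 3) = 0 :=
      Quot.sound Rel.zigzag_left
    have h0 : cupRight k 0 = Hom.cup k := by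
      rw [cupRight, capRight_zero]
      change Hom.bar (Hom.cap k ⊠ Hom.id k 0) = _
      rw [Hom.tensor_unit]
      rfl
    rw [h0]
    exact h
  | succ t ih =>
    rw [← addLeft_cupRight, ← addLeft_capRight, ← Hom.addLeft_addRight, ← Hom.addLeft_comp, ih,
      map_zero]

theorem Hom.addRight_cast {k : Type*} [CommRing k] {a b b' : ℕ} (f : Hom k a b) (h : b = b') :
    Hom.addRight (f.cast rfl h) = (Hom.addRight f).cast rfl (congrArg (· + 1) h) := by
  subst h
  rfl

/-! ### Removing the last strand or the last cap from `x̄ ∘ x` -/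

namespace CapDiagram

variable {m n : ℕ}

theorem left_partner_of_castAdd {x : CapDiagram (m + n)} {i j : Fin m}
    (h : x.partner (Fin.castAdd n i) = Fin.castAdd n j) : x.left.partner i = j := by
  unfold left
  simp only [h, Fin.addCases_left]

theorem left_partner_of_natAdd {x : CapDiagram (m + n)} {i : Fin m} {j : Fin n}
    (h : x.partner (Fin.castAdd n i) = Fin.natAdd m j) : x.left.partner i = i := by
  unfold left
  simp only [h, Fin.addCases_right]

theorem left_partner_congr {x y : CapDiagram (m + n)} {i : Fin m}
    (h : x.partner (Fin.castAdd n i) = y.partner (Fin.castAdd n i)) :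
    x.left.partner i = y.left.partner i := by
  unfold left
  simp only [h]

theorem toHom_of_fixed {x : CapDiagram (n + 1)} (h : x.partner (Fin.last n) = Fin.last n) :
    x.toHom k = (Hom.addRight ((left (m := n) (n := 1) x).toHom k)).cast rfl
      (th_left_of_last_fixed x h) := by
  rw [toHom, dif_pos h]
  rfl

theorem toHom_of_capped {x : CapDiagram (n + 1)} (h : x.partner (Fin.last n) ≠ Fin.last n) :
    x.toHom k = capRight k x.th ⊚ (Hom.addRight ((left (m := n) (n := 1) x).toHom k)).cast rfl
      (congrArg (· + 1) (th_left_of_last_capped x h)) := by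
  rw [toHom, dif_neg h]
  rfl

theorem bar_toHom_comp_toHom_of_fixed {x : CapDiagram (n + 1)}
    (h : x.partner (Fin.last n) = Fin.last n) :
    (x.toHom k).bar ⊚ x.toHom k = Hom.addRight
      (((left (m := n) (n := 1) x).toHom k).bar ⊚ (left (m := n) (n := 1) x).toHom k) := by
  rw [toHom_of_fixed h, Hom.addRight_comp, Hom.addRight_bar, Hom.cast_bar]
  exact (Hom.cast_comp _ _ _ _ _ _).symm

/-- The two hypotheses force a cap joining the last two strands, since a capped last strand takes
the rightmost through strand of the rest. Such an `x` is a diagram on `n` strands preceded by a cap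
on the right. -/
theorem bar_toHom_comp_toHom_of_capped {x : CapDiagram (n + 1 + 1)}
    (h : x.partner (Fin.last (n + 1)) ≠ Fin.last (n + 1))
    (h' : (left (m := n + 1) (n := 1) x).partner (Fin.last n) = Fin.last n) :
    (x.toHom k).bar ⊚ x.toHom k = cupRight k n ⊚
      (((left (m := n) (n := 1) (left (m := n + 1) (n := 1) x)).toHom k).bar ⊚
        (left (m := n) (n := 1) (left (m := n + 1) (n := 1) x)).toHom k) ⊚ capRight k n := by
  -- Stated for free indices `s`, `t`, so that the equality between counts of through strands can be
  -- eliminated.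
  have key : ∀ (s t : ℕ) (u : Hom k n s) (e : s + 1 = t + 1) (e' : s + 2 = t + 2),
      capRight k t ⊚ (Hom.addRight (Hom.addRight u)).cast rfl e' =
        (u ⊚ capRight k n).cast rfl (Nat.succ.inj e) := by
    intro s t u e e'
    cases e
    exact capRight_comp u
  have h1 := toHom_of_fixed (k := k) h'
  have h2 := toHom_of_capped (k := k) h
  have e1 := th_left_of_last_fixed _ h'
  have e2 := th_left_of_last_capped _ h
  have h3 : x.toHom k = ((left (m := n) (n := 1) (left (m := n + 1) (n := 1) x)).toHom k ⊚
      capRight k n).cast rfl (by omega) := by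
    rw [h2, h1, ← key _ _ _ (by omega) (by omega), Hom.addRight_cast, Hom.cast_cast]
  rw [h3, Hom.cast_bar, Hom.bar_comp]
  refine (Hom.cast_comp _ _ _ rfl _ rfl).symm.trans ?_
  simp only [Hom.cast_rfl, Hom.comp_assoc]
  rfl

end CapDiagram

/-! ### Apt subsets, split at the right end -/

section Apt

variable {n : ℕ}

theorem capOfApt_of_mem {I : Finset (Fin n)} (hI : Apt I) {i j : Fin n} (hi : i ∈ I)
    (hj : (j : ℕ) = i + 1) : (capOfApt I hI).partner i = j := by
  rw [capOfApt]
  simp only [dif_pos hi]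
  exact Fin.ext hj.symm

theorem capOfApt_of_pred_mem {I : Finset (Fin n)} (hI : Apt I) {i j : Fin n} (hi : i ∈ I)
    (hj : (j : ℕ) = i + 1) : (capOfApt I hI).partner j = i := by
  rw [← capOfApt_of_mem hI hi hj, (capOfApt I hI).partner_partner]

theorem capOfApt_of_notMem {I : Finset (Fin n)} (hI : Apt I) {j : Fin n} (hj : j ∉ I)
    (h : ∀ i ∈ I, (j : ℕ) ≠ i + 1) : (capOfApt I hI).partner j = j := by
  rw [capOfApt]
  simp only [dif_neg hj]
  rw [dif_neg]
  rintro ⟨i, hi, e⟩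
  exact h i hi e

theorem Apt.map_castSucc {I : Finset (Fin n)} (hI : Apt I) : Apt (I.map Fin.castSuccEmb) := by
  intro i hi
  obtain ⟨i, hi', rfl⟩ := Finset.mem_map.mp hi
  obtain ⟨h1, h2⟩ := hI i hi'
  refine ⟨?_, fun j hj => ?_⟩
  · simp only [Fin.coe_castSuccEmb, Fin.val_castSucc]
    omega
  · obtain ⟨j, hj', rfl⟩ := Finset.mem_map.mp hj
    exact h2 j hj'

theorem Apt.insert_last {I : Finset (Fin n)} (hI : Apt I) :
    Apt (insert (Fin.last n).castSucc ((I.map Fin.castSuccEmb).map Fin.castSuccEmb)) := by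
  intro i hi
  have h : ∀ i ∈ (I.map Fin.castSuccEmb).map Fin.castSuccEmb, (i : ℕ) + 1 < n := by
    intro i hi
    simp only [Finset.mem_map] at hi
    obtain ⟨_, ⟨i, hi, rfl⟩, rfl⟩ := hi
    exact (hI i hi).1
  have hl : (((Fin.last n).castSucc : Fin (n + 2)) : ℕ) = n := rfl
  rw [Finset.mem_insert] at hi
  refine ⟨?_, fun j hj => ?_⟩
  · obtain rfl | hi := hi
    · omega
    · have := h i hi
      omega
  · rw [Finset.mem_insert] at hj
    obtain rfl | hi := hi
    · obtain rfl | hj := hj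
      · omega
      · have := h j hj
        omega
    · obtain rfl | hj := hj
      · have := h i hi
        omega
      · exact (hI.map_castSucc.map_castSucc i hi).2 j hj

theorem left_capOfApt_map {I : Finset (Fin n)} (hI : Apt I) :
    CapDiagram.left (m := n) (n := 1) (capOfApt _ hI.map_castSucc) = capOfApt I hI := by
  ext1
  funext j
  apply CapDiagram.left_partner_of_castAdd
  by_cases h : j ∈ I
  · have := (hI j h).1
    rw [capOfApt_of_mem hI (j := ⟨j + 1, this⟩) h rfl]
    exact capOfApt_of_mem _ (Finset.mem_map_of_mem Fin.castSuccEmb h) rfl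
  by_cases h' : ∃ i ∈ I, (j : ℕ) = i + 1
  · obtain ⟨i, hi, e⟩ := h'
    rw [capOfApt_of_pred_mem hI hi e]
    exact capOfApt_of_pred_mem _ (Finset.mem_map_of_mem Fin.castSuccEmb hi) e
  · rw [capOfApt_of_notMem hI h fun i hi e => h' ⟨i, hi, e⟩]
    apply capOfApt_of_notMem
    · exact fun hj => h ((Finset.mem_map' Fin.castSuccEmb).mp hj)
    · intro i hi e
      obtain ⟨i, hi', rfl⟩ := Finset.mem_map.mp hi
      exact h' ⟨i, hi', e⟩

theorem capOfApt_map_last {I : Finset (Fin n)} (hI : Apt I) :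
    (capOfApt _ hI.map_castSucc).partner (Fin.last n) = Fin.last n := by
  apply capOfApt_of_notMem
  · intro h
    obtain ⟨i, hi, e⟩ := Finset.mem_map.mp h
    exact (Fin.castSucc_lt_last i).ne e
  · intro i hi e
    obtain ⟨i, hi', rfl⟩ := Finset.mem_map.mp hi
    have := (hI i hi').1
    simp at e
    omega

theorem capOfApt_insert_last {I : Finset (Fin n)} (hI : Apt I) :
    (capOfApt _ hI.insert_last).partner (Fin.last (n + 1)) = (Fin.last n).castSucc :=
  capOfApt_of_pred_mem _ (Finset.mem_insert_self _ _) rfl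

theorem left_capOfApt_insert_last {I : Finset (Fin n)} (hI : Apt I) :
    CapDiagram.left (m := n + 1) (n := 1) (capOfApt _ hI.insert_last) =
      capOfApt _ hI.map_castSucc := by
  ext1
  funext j
  have hl : (((Fin.last n).castSucc : Fin (n + 2)) : ℕ) = n := rfl
  rcases Fin.eq_castSucc_or_eq_last j with ⟨j, rfl⟩ | rfl
  · rw [← left_capOfApt_map hI.map_castSucc]
    have hj : (j.castSucc.castSucc : Fin (n + 2)) ≠ (Fin.last n).castSucc := by
      simp [Fin.ext_iff, j.isLt.ne]
    have hj' := j.isLt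
    apply CapDiagram.left_partner_congr
    set J := (I.map Fin.castSuccEmb).map Fin.castSuccEmb with hJ
    change (capOfApt _ hI.insert_last).partner j.castSucc.castSucc =
      (capOfApt J _).partner j.castSucc.castSucc
    by_cases h : j.castSucc.castSucc ∈ J
    · rw [capOfApt_of_mem _ (j := j.succ.castSucc) h (by simp)]
      exact capOfApt_of_mem _ (Finset.mem_insert_of_mem h) (by simp)
    by_cases h' : ∃ i ∈ J, (j.castSucc.castSucc : ℕ) = i + 1
    · obtain ⟨i, hi, e⟩ := h'
      rw [capOfApt_of_pred_mem _ hi e]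
      exact capOfApt_of_pred_mem _ (Finset.mem_insert_of_mem hi) e
    · rw [capOfApt_of_notMem _ h fun i hi e => h' ⟨i, hi, e⟩]
      apply capOfApt_of_notMem
      · simp only [Finset.mem_insert, not_or]
        exact ⟨hj, h⟩
      · intro i hi e
        rw [Finset.mem_insert] at hi
        obtain rfl | hi := hi
        · simp at e
          omega
        · exact h' ⟨i, hi, e⟩
  · rw [capOfApt_map_last hI]
    exact CapDiagram.left_partner_of_natAdd (j := 0)
      (capOfApt_of_mem _ (Finset.mem_insert_self _ _) rfl)

/-- Apt subsets split according to whether the last two positions are joined by a cap. -/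
def aptSum (n : ℕ) :
    {I : Finset (Fin (n + 1)) // Apt I} ⊕ {I : Finset (Fin n) // Apt I} →
      {I : Finset (Fin (n + 2)) // Apt I} :=
  Sum.elim (fun I => ⟨_, I.2.map_castSucc⟩) (fun I => ⟨_, I.2.insert_last⟩)

theorem last_notMem_of_apt {I : Finset (Fin (n + 1))} (hI : Apt I) : Fin.last n ∉ I :=
  fun h => lt_irrefl _ (hI _ h).1

/-- The position `(Fin.last n).castSucc` decides the side. The last position never lies in an apt
set; if the one before it does, aptness excludes its predecessor as well, and what remains is apt in
`Fin n`. -/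
theorem aptSum_bijective (n : ℕ) : Function.Bijective (aptSum n) := by
  have hne : ∀ (I : {I : Finset (Fin (n + 1)) // Apt I}) (J : {I : Finset (Fin n) // Apt I}),
      aptSum n (.inl I) ≠ aptSum n (.inr J) := by
    intro I J e
    have h : (Fin.last n).castSucc ∈ I.1.map Fin.castSuccEmb := by
      rw [show I.1.map Fin.castSuccEmb = _ from congrArg Subtype.val e]
      exact Finset.mem_insert_self _ _
    exact last_notMem_of_apt I.2 ((Finset.mem_map' Fin.castSuccEmb).mp h)
  have hnot : ∀ (I : Finset (Fin n)),
      (Fin.last n).castSucc ∉ (I.map Fin.castSuccEmb).map Fin.castSuccEmb := by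
    intro I h
    obtain ⟨i, -, e⟩ := Finset.mem_map.mp ((Finset.mem_map' Fin.castSuccEmb).mp h)
    exact (Fin.castSucc_lt_last i).ne e
  constructor
  · rintro (I | I) (J | J) e
    · have := congrArg Subtype.val e
      exact congrArg Sum.inl (Subtype.ext (Finset.map_injective _ this))
    · exact absurd e (hne _ _)
    · exact absurd e.symm (hne _ _)
    · have h : insert _ _ = insert _ _ := congrArg Subtype.val e
      have := congrArg (fun s => s.erase (Fin.last n).castSucc) h
      simp only [Finset.erase_insert (hnot _)] at this
      exact congrArg Sum.inr
        (Subtype.ext (Finset.map_injective _ (Finset.map_injective _ this)))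
  · rintro ⟨J, hJ⟩
    by_cases h : (Fin.last n).castSucc ∈ J
    · let I : Finset (Fin n) := Finset.univ.filter fun i => i.castSucc.castSucc ∈ J
      have hlt : ∀ i : Fin n, i.castSucc.castSucc ∈ J → (i : ℕ) + 1 < n := by
        intro i hi
        have h1 := (hJ _ hi).2 _ h
        have h2 : (((Fin.last n).castSucc : Fin (n + 2)) : ℕ) = n := rfl
        rw [h2] at h1
        simp only [Fin.val_castSucc] at h1
        have := i.isLt
        omega
      have hI : Apt I := by
        intro i hi
        have hi' := (Finset.mem_filter.mp hi).2
        exact ⟨hlt i hi', fun j hj => (hJ _ hi').2 _ (Finset.mem_filter.mp hj).2⟩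
      refine ⟨.inr ⟨I, hI⟩, Subtype.ext ?_⟩
      change insert _ _ = J
      ext j
      rw [Finset.mem_insert, Finset.map_map, Finset.mem_map]
      constructor
      · rintro (rfl | ⟨i, hi, rfl⟩)
        · exact h
        · exact (Finset.mem_filter.mp hi).2
      · intro hj
        rcases Fin.eq_castSucc_or_eq_last j with ⟨j, rfl⟩ | rfl
        · rcases Fin.eq_castSucc_or_eq_last j with ⟨j, rfl⟩ | rfl
          · exact Or.inr ⟨j, Finset.mem_filter.mpr ⟨Finset.mem_univ _, hj⟩, rfl⟩
          · exact Or.inl rfl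
        · exact absurd hj (last_notMem_of_apt hJ)
    · let I : Finset (Fin (n + 1)) := Finset.univ.filter fun i => i.castSucc ∈ J
      have hI : Apt I := by
        intro i hi
        have hi' := (Finset.mem_filter.mp hi).2
        refine ⟨?_, fun j hj => (hJ _ hi').2 _ (Finset.mem_filter.mp hj).2⟩
        have : (i : ℕ) ≠ n := by
          intro e
          exact h ((show i = Fin.last n from Fin.ext e) ▸ hi')
        omega
      refine ⟨.inl ⟨I, hI⟩, Subtype.ext ?_⟩
      change Finset.map _ I = J
      ext j
      rw [Finset.mem_map]
      constructor
      · rintro ⟨i, hi, rfl⟩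
        exact (Finset.mem_filter.mp hi).2
      · intro hj
        rcases Fin.eq_castSucc_or_eq_last j with ⟨j, rfl⟩ | rfl
        · exact ⟨j, Finset.mem_filter.mpr ⟨Finset.mem_univ _, hj⟩, rfl⟩
        · exact absurd hj (last_notMem_of_apt hJ)

end Apt

/-! ### Jones–Wenzl projectors -/

section JonesWenzl

theorem Apt.eq_empty {n : ℕ} (hn : n ≤ 1) {I : Finset (Fin n)} (hI : Apt I) : I = ∅ := by
  refine Finset.eq_empty_of_forall_notMem fun i hi => ?_
  have := (hI i hi).1
  omega

theorem jonesWenzl_eq_of_le_one {n : ℕ} (hn : n ≤ 1) (h : Apt (∅ : Finset (Fin n))) :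
    jonesWenzl k n = ((capOfApt ∅ h).toHom k).bar ⊚ (capOfApt ∅ h).toHom k := by
  classical
  rw [jonesWenzl, Fintype.sum_eq_single ⟨∅, h⟩]
  · simp
  · rintro ⟨I, hI⟩ hne
    exact absurd (Subtype.ext (hI.eq_empty hn)) hne

theorem bar_toHom_comp_toHom_zero (x : CapDiagram 0) :
    (x.toHom k).bar ⊚ x.toHom k = Hom.id k 0 := by
  rw [CapDiagram.toHom, Hom.cast_bar]
  refine (Hom.cast_comp _ _ _ _ _ _).symm.trans ?_
  simp

@[simp] theorem jonesWenzl_zero : jonesWenzl k 0 = Hom.id k 0 := by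
  rw [jonesWenzl_eq_of_le_one (by omega) (by simp [Apt]), bar_toHom_comp_toHom_zero]

@[simp] theorem jonesWenzl_one : jonesWenzl k 1 = Hom.id k 1 := by
  rw [jonesWenzl_eq_of_le_one (by omega) (by simp [Apt]),
    CapDiagram.bar_toHom_comp_toHom_of_fixed (n := 0) (Subsingleton.elim (α := Fin 1) _ _),
    bar_toHom_comp_toHom_zero, Hom.addRight_id]

/-- Split the defining sum by whether a cap joins the last two strands. If not, the last strand is
through and factors off; if so, that cap contributes a sign and surrounds the remaining term by a
cup and a cap. -/
theorem jonesWenzl_succ_succ (n : ℕ) :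
    jonesWenzl k (n + 2) = Hom.addRight (jonesWenzl k (n + 1)) +
      (-1 : k) • (cupRight k n ⊚ jonesWenzl k n ⊚ capRight k n) := by
  classical
  rw [jonesWenzl, ← (Equiv.ofBijective _ (aptSum_bijective n)).sum_comp, Fintype.sum_sum_type]
  congr 1
  · rw [jonesWenzl, map_sum]
    refine Finset.sum_congr (by ext; simp) fun I _ => ?_
    rw [map_smul]
    change (-1 : k) ^ (I.1.map Fin.castSuccEmb).card •
      (((capOfApt _ I.2.map_castSucc).toHom k).bar ⊚ (capOfApt _ I.2.map_castSucc).toHom k) = _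
    rw [Finset.card_map, CapDiagram.bar_toHom_comp_toHom_of_fixed (capOfApt_map_last I.2),
      left_capOfApt_map]
  · rw [jonesWenzl, Hom.sum_comp, Hom.comp_sum, Finset.smul_sum]
    refine Finset.sum_congr (by ext; simp) fun I _ => ?_
    change (-1 : k) ^ (insert _ _ : Finset (Fin (n + 2))).card •
      (((capOfApt _ I.2.insert_last).toHom k).bar ⊚ (capOfApt _ I.2.insert_last).toHom k) = _
    rw [Finset.card_insert_of_notMem, Finset.card_map, Finset.card_map,
      CapDiagram.bar_toHom_comp_toHom_of_capped, Hom.smul_comp, Hom.comp_smul, smul_smul,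
      pow_succ']
    · congr 2
      rw [left_capOfApt_insert_last I.2, left_capOfApt_map I.2]
    · rw [capOfApt_insert_last I.2]
      exact (Fin.castSucc_lt_last _).ne
    · rw [left_capOfApt_insert_last I.2]
      exact capOfApt_map_last I.2
    · intro h
      obtain ⟨i, -, e⟩ := Finset.mem_map.mp ((Finset.mem_map' Fin.castSuccEmb).mp h)
      exact (Fin.castSucc_lt_last i).ne e

@[simp] theorem jonesWenzl_bar (n : ℕ) : (jonesWenzl k n).bar = jonesWenzl k n := by
  classical
  change Hom.barLinear (jonesWenzl k n) = _
  rw [jonesWenzl, map_sum]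
  refine Finset.sum_congr rfl fun I _ => ?_
  rw [map_smul]
  change _ • Hom.bar _ = _
  rw [Hom.bar_comp, Hom.bar_bar]

/-- In the recursion for `j_{t+1}` the correction term meets the cap in a zig-zag and vanishes,
while the cap slides past the main term. -/
theorem capRight_comp_addRight_jonesWenzl (t : ℕ) :
    capRight k t ⊚ Hom.addRight (jonesWenzl k (t + 1)) = jonesWenzl k t ⊚ capRight k t := by
  cases t with
  | zero => simp
  | succ t =>
    rw [jonesWenzl_succ_succ, map_add, map_smul, Hom.comp_add, Hom.comp_smul, capRight_comp,
      Hom.addRight_comp, ← Hom.comp_assoc, capRight_comp_addRight_cupRight, Hom.zero_comp,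
      smul_zero, add_zero]

theorem addRight_jonesWenzl_comp_cupRight (t : ℕ) :
    Hom.addRight (jonesWenzl k (t + 1)) ⊚ cupRight k t = cupRight k t ⊚ jonesWenzl k t := by
  have := congrArg Hom.bar (capRight_comp_addRight_jonesWenzl (k := k) t)
  simpa [Hom.bar_comp, ← Hom.addRight_bar, cupRight] using this

/-- The hom modules carry only an additive monoid structure, so cancellation is drawn from the
scalars. -/
theorem add_neg_one_smul_self {M : Type*} [AddCommMonoid M] [Module k M] (a : M) :
    a + (-1 : k) • a = 0 := by
  rw [← one_smul k a, smul_smul, ← add_smul]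
  simp

/-- Against the cup, both terms of the recursion become `cup ∘ j_t`, the second because the circle
is the identity, and their signs are opposite. -/
theorem jonesWenzl_comp_cupRight (t : ℕ) : jonesWenzl k (t + 2) ⊚ cupRight k t = 0 := by
  rw [jonesWenzl_succ_succ, Hom.add_comp, Hom.smul_comp, addRight_jonesWenzl_comp_cupRight,
    Hom.comp_assoc, Hom.comp_assoc, capRight_comp_cupRight, Hom.comp_id, add_neg_one_smul_self]

theorem capRight_comp_jonesWenzl (t : ℕ) : capRight k t ⊚ jonesWenzl k (t + 2) = 0 := by
  have := congrArg Hom.bar (jonesWenzl_comp_cupRight (k := k) t)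
  rw [Hom.bar_comp, jonesWenzl_bar, cupRight, Hom.bar_bar] at this
  exact this.trans (map_zero Hom.barLinear)

/-- The parts are proved jointly: absorption of `j_{t+1} ⊗ 1` into `j_{t+2}` needs idempotence of
both `j_t` and `j_{t+1}`; idempotence of `j_{t+2}` then follows, since it kills the cup in the
recursion. -/
theorem jonesWenzl_idempotent_aux (t : ℕ) :
    jonesWenzl k t ⊚ jonesWenzl k t = jonesWenzl k t ∧
      jonesWenzl k (t + 1) ⊚ jonesWenzl k (t + 1) = jonesWenzl k (t + 1) ∧
      jonesWenzl k (t + 1) ⊚ Hom.addRight (jonesWenzl k t) = jonesWenzl k (t + 1) := by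
  induction t with
  | zero => simp
  | succ t ih =>
    have h : jonesWenzl k (t + 2) ⊚ Hom.addRight (jonesWenzl k (t + 1)) = jonesWenzl k (t + 2) := by
      rw [jonesWenzl_succ_succ, Hom.add_comp, Hom.smul_comp, ← Hom.addRight_comp, ih.2.1,
        Hom.comp_assoc, Hom.comp_assoc, capRight_comp_addRight_jonesWenzl, ← Hom.comp_assoc,
        ← Hom.comp_assoc, Hom.comp_assoc (cupRight k t), ih.1, Hom.comp_assoc]
    refine ⟨ih.2.1, ?_, h⟩
    conv_lhs =>
      arg 2
      rw [jonesWenzl_succ_succ]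
    rw [Hom.comp_add, Hom.comp_smul, h, ← Hom.comp_assoc, jonesWenzl_comp_cupRight, Hom.zero_comp,
      smul_zero, add_zero]

theorem jonesWenzl_comp_self (t : ℕ) : jonesWenzl k t ⊚ jonesWenzl k t = jonesWenzl k t :=
  (jonesWenzl_idempotent_aux t).1

theorem jonesWenzl_comp_addRight (t : ℕ) :
    jonesWenzl k (t + 1) ⊚ Hom.addRight (jonesWenzl k t) = jonesWenzl k (t + 1) :=
  (jonesWenzl_idempotent_aux t).2.2

theorem addRight_comp_jonesWenzl (t : ℕ) :
    Hom.addRight (jonesWenzl k t) ⊚ jonesWenzl k (t + 1) = jonesWenzl k (t + 1) := by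
  have := congrArg Hom.bar (jonesWenzl_comp_addRight (k := k) t)
  rwa [Hom.bar_comp, jonesWenzl_bar, ← Hom.addRight_bar, jonesWenzl_bar] at this

theorem jonesWenzl_two :
    jonesWenzl k 2 = Hom.id k 2 + (-1 : k) • (cupRight k 0 ⊚ capRight k 0) := by
  have h := jonesWenzl_succ_succ (k := k) 0
  have h1 : jonesWenzl k (0 + 1) = Hom.id k 1 := jonesWenzl_one
  rw [h1, jonesWenzl_zero, Hom.addRight_id, Hom.id_comp] at h
  exact h

/-- The mirror image of the recursion `jonesWenzl_succ_succ`. -/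
theorem addLeft_jonesWenzl (n : ℕ) :
    Hom.addLeft (jonesWenzl k (n + 1)) = jonesWenzl k (n + 2) +
      cupLeft k n ⊚ jonesWenzl k n ⊚ capLeft k n := by
  induction n using Nat.strong_induction_on with
  | _ n ih =>
    match n with
    | 0 =>
      have h : cupLeft k 0 = cupRight k 0 := by rw [cupLeft, cupRight, capRight_zero]
      change Hom.addLeft (jonesWenzl k 1) = jonesWenzl k 2 + _
      rw [jonesWenzl_two, h, ← capRight_zero, jonesWenzl_one, jonesWenzl_zero, Hom.addLeft_id,
        Hom.id_comp, add_assoc, add_comm (_ • _), add_neg_one_smul_self, add_zero]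
    -- The general step applies the induction hypothesis to both terms of the right recursion. Here
    -- one term contains `1 ⊗ j_0`, which the statement does not cover.
    | 1 =>
      have h : Hom.addLeft (jonesWenzl k 1) = jonesWenzl k 2 + _ := ih 0 (by omega)
      have h' := congrArg Hom.addRight h
      have e : jonesWenzl k 3 = Hom.addRight (jonesWenzl k 2) + _ := jonesWenzl_succ_succ 1
      have e1 : Hom.addRight (capLeft k 0) = capLeft k 1 := addRight_capLeft 0
      have e2 : Hom.addRight (cupLeft k 0) = cupLeft k 1 := addRight_cupLeft 0
      have e3 : Hom.addLeft (capRight k 0) = capRight k 1 := addLeft_capRight 0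
      have e4 : Hom.addLeft (cupRight k 0) = cupRight k 1 := addLeft_cupRight 0
      rw [jonesWenzl_zero, Hom.id_comp, map_add, Hom.addRight_comp, e1, e2, jonesWenzl_one,
        Hom.addLeft_id, Hom.addRight_id] at h'
      change Hom.addLeft (jonesWenzl k 2) = jonesWenzl k 3 + _
      rw [e, jonesWenzl_one, Hom.id_comp, Hom.id_comp, add_right_comm, ← h']
      conv_lhs => rw [jonesWenzl_two]
      rw [map_add, map_smul, Hom.addLeft_comp, e3, e4, Hom.addLeft_id]
    -- Expand `j_{n+3}` by the right recursion and apply the induction hypothesis to `1 ⊗ j_{n+2}`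
    -- and `1 ⊗ j_{n+1}`. Expanding the right-hand side by the same recursion gives the same four
    -- terms, once left and right cups and caps are commuted (`h5`).
    | n + 2 =>
      have h1 := ih n (by omega)
      have h2 := congrArg Hom.addRight (ih (n + 1) (by omega))
      have c1 := capRight_comp_capLeft (k := k) n
      have c2 := cupLeft_comp_cupRight (k := k) n
      have e1 : jonesWenzl k (n + 2 + 2) = _ := jonesWenzl_succ_succ (n + 2)
      have e2 : jonesWenzl k (n + 2 + 1) = _ := jonesWenzl_succ_succ (n + 1)
      have e3 := jonesWenzl_succ_succ (k := k) n
      have h3 := congrArg (fun f => cupRight k (n + 2) ⊚ f ⊚ capRight k (n + 2)) h1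
      have h4 := congrArg (fun f => cupLeft k (n + 2) ⊚ f ⊚ capLeft k (n + 2)) e3
      simp only [map_add, Hom.addRight_comp, addRight_capLeft, addRight_cupLeft,
        Hom.comp_add, Hom.add_comp, Hom.comp_smul, Hom.smul_comp] at h2 h3 h4
      have h5 : cupLeft k (n + 2) ⊚ (cupRight k n ⊚ jonesWenzl k n ⊚ capRight k n) ⊚
          capLeft k (n + 2) = cupRight k (n + 2) ⊚ (cupLeft k n ⊚ jonesWenzl k n ⊚ capLeft k n) ⊚
          capRight k (n + 2) := by
        simp only [Hom.comp_assoc, c1]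
        rw [← Hom.comp_assoc, c2, Hom.comp_assoc]
      rw [e2, map_add, map_smul, Hom.addLeft_addRight, Hom.addLeft_comp, Hom.addLeft_comp,
        addLeft_capRight, addLeft_cupRight, h2, e1, h4, h5, h3]
      simp only [smul_add]
      exact add_add_add_comm _ _ _ _

end JonesWenzl

/-! ### Paths: a combinatorial encoding of cap diagrams -/

/-- Cap diagrams on `n` strands with `t` through strands, built up strand by strand from the left:
a new strand is a through strand or is capped with the rightmost through strand. -/
inductive Path : ℕ → ℕ → Type
  | nil : Path 0 0
  | thru {n t : ℕ} (p : Path n t) : Path (n + 1) (t + 1)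
  | capd {n t : ℕ} (p : Path n (t + 1)) : Path (n + 1) t

namespace Path

/-- Adding a through strand on the left. -/
def thruLeft : ∀ {n t : ℕ}, Path n t → Path (n + 1) (t + 1)
  | _, _, nil => thru nil
  | _, _, thru p => thru p.thruLeft
  | _, _, capd p => capd p.thruLeft

/-- Adding a strand on the left and capping it with the leftmost through strand. -/
def capdLeft : ∀ {n t : ℕ}, Path n (t + 1) → Path (n + 1) t
  -- The last strand is the only through strand, so the new first strand is capped with it: the new
  -- strand is through until the last one arrives.
  | _, 0, thru p => capd p.thruLeft
  | _, _ + 1, thru p => thru p.capdLeft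
  | _, _, capd p => capd p.capdLeft

/-- The left-right reflection. -/
def reflect : ∀ {n t : ℕ}, Path n t → Path n t
  | _, _, nil => nil
  | _, _, thru p => p.reflect.thruLeft
  | _, _, capd p => p.reflect.capdLeft

theorem reflect_thruLeft {n t : ℕ} (p : Path n t) : p.thruLeft.reflect = thru p.reflect := by
  induction p with
  | nil => rfl
  | thru p ih => simp only [thruLeft, reflect, ih]
  | capd p ih => simp only [thruLeft, reflect, ih, capdLeft]

theorem reflect_capdLeft {n t : ℕ} (p : Path n (t + 1)) : p.capdLeft.reflect = capd p.reflect := by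
  induction n generalizing t with
  | zero => nomatch p
  | succ n ih =>
    cases p with
    | thru p =>
      cases t with
      | zero =>
        simp only [capdLeft, reflect, reflect_thruLeft]
      | succ t =>
        simp only [capdLeft, reflect, ih]
        generalize p.reflect = q
        cases q with
        | thru q => rfl
        | capd q => rfl
    | capd p => simp only [capdLeft, reflect, ih]

theorem reflect_reflect {n t : ℕ} (p : Path n t) : p.reflect.reflect = p := by
  induction p with
  | nil => rfl
  | thru p ih => rw [reflect, reflect_thruLeft, ih]
  | capd p ih => rw [reflect, reflect_capdLeft, ih]

/-- Reflection is an involution turning `thruLeft` and `capdLeft` into the constructors `thru` and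
`capd`; injectivity and disjointness of constructors carry over to the left-hand operations. -/
theorem thruLeft_injective {n t : ℕ} : Function.Injective (@thruLeft n t) := by
  intro p q h
  have h' := congrArg reflect h
  rw [reflect_thruLeft, reflect_thruLeft] at h'
  rw [← reflect_reflect p, ← reflect_reflect q]
  injection h' with _ _ h'
  rw [h']

theorem capdLeft_injective {n t : ℕ} : Function.Injective (@capdLeft n t) := by
  intro p q h
  have h' := congrArg reflect h
  rw [reflect_capdLeft, reflect_capdLeft] at h'
  rw [← reflect_reflect p, ← reflect_reflect q]
  injection h' with _ _ h'
  rw [h']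

theorem thruLeft_ne_capdLeft {n t : ℕ} (p : Path n t) (q : Path n (t + 2)) :
    p.thruLeft ≠ q.capdLeft := by
  intro h
  have h' := congrArg reflect h
  rw [reflect_thruLeft, reflect_capdLeft] at h'
  nomatch h'

/-! ### Morphisms of paths and their orthogonality -/

section toHom

variable (k)

/-- The morphism depicted by a path. -/
def toHom : ∀ {n t : ℕ}, Path n t → Hom k n t
  | _, _, nil => Hom.id k 0
  | _, _, thru p => Hom.addRight p.toHom
  | _, t, capd p => capRight k t ⊚ Hom.addRight p.toHom

variable {k}

theorem toHom_thruLeft {n t : ℕ} (p : Path n t) :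
    p.thruLeft.toHom k = Hom.addLeft (p.toHom k) := by
  induction p with
  | nil => simp [thruLeft, toHom]
  | thru p ih => rw [thruLeft, toHom, toHom, ih, Hom.addLeft_addRight]
  | capd p ih =>
    rw [thruLeft, toHom, toHom, ih, Hom.addLeft_comp, addLeft_capRight, Hom.addLeft_addRight]

theorem toHom_capdLeft {n t : ℕ} (p : Path n (t + 1)) :
    p.capdLeft.toHom k = capLeft k t ⊚ Hom.addLeft (p.toHom k) := by
  induction n generalizing t with
  | zero => nomatch p
  | succ n ih =>
    cases p with
    | thru p =>
      cases t with
      | zero =>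
        simp only [capdLeft, toHom, toHom_thruLeft, capRight_zero, Hom.addLeft_addRight]
      | succ t =>
        rw [capdLeft, toHom, toHom, ih, Hom.addRight_comp, addRight_capLeft, Hom.addLeft_addRight]
    | capd p =>
      rw [capdLeft, toHom, toHom, ih, Hom.addRight_comp, addRight_capLeft, ← Hom.comp_assoc,
        capRight_comp_capLeft, Hom.addLeft_comp, addLeft_capRight, Hom.addLeft_addRight,
        Hom.comp_assoc]

/-- This and the next three lemmas place a projector next to the shorter path, so that an induction
hypothesis about `jonesWenzl k t ⊚ p.toHom k` applies under `Hom.addRight`. -/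
theorem jonesWenzl_comp_toHom_thru {n t : ℕ} (p : Path n t) :
    jonesWenzl k (t + 1) ⊚ (thru p).toHom k =
      jonesWenzl k (t + 1) ⊚ Hom.addRight (jonesWenzl k t ⊚ p.toHom k) := by
  rw [Hom.addRight_comp, ← Hom.comp_assoc, jonesWenzl_comp_addRight, toHom]

theorem jonesWenzl_comp_toHom_capd {n t : ℕ} (p : Path n (t + 1)) :
    jonesWenzl k t ⊚ (capd p).toHom k =
      capRight k t ⊚ Hom.addRight (jonesWenzl k (t + 1) ⊚ p.toHom k) := by
  rw [Hom.addRight_comp, ← Hom.comp_assoc, capRight_comp_addRight_jonesWenzl, toHom, Hom.comp_assoc]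

theorem bar_toHom_thru_comp_jonesWenzl {n t : ℕ} (p : Path n t) :
    ((thru p).toHom k).bar ⊚ jonesWenzl k (t + 1) =
      Hom.addRight ((p.toHom k).bar ⊚ jonesWenzl k t) ⊚ jonesWenzl k (t + 1) := by
  have := congrArg Hom.bar (jonesWenzl_comp_toHom_thru (k := k) p)
  simpa only [Hom.bar_comp, jonesWenzl_bar, ← Hom.addRight_bar] using this

theorem bar_toHom_capd_comp_jonesWenzl {n t : ℕ} (p : Path n (t + 1)) :
    ((capd p).toHom k).bar ⊚ jonesWenzl k t =
      Hom.addRight ((p.toHom k).bar ⊚ jonesWenzl k (t + 1)) ⊚ cupRight k t := by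
  have := congrArg Hom.bar (jonesWenzl_comp_toHom_capd (k := k) p)
  simpa only [Hom.bar_comp, jonesWenzl_bar, ← Hom.addRight_bar, cupRight] using this

/-- After the last strand is removed from both copies, the middle collapses to a projector by
induction. A through strand leaves `j_{t+1} ∘ (j_t ⊗ 1) ∘ j_{t+1}`; a capped one leaves `cap ∘
(j_{t+1} ⊗ 1) ∘ cup = j_t`. -/
theorem jonesWenzl_toHom_self {n t : ℕ} (p : Path n t) :
    (jonesWenzl k t ⊚ p.toHom k) ⊚ (p.toHom k).bar ⊚ jonesWenzl k t = jonesWenzl k t := by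
  induction p with
  | nil => simp [toHom]
  | thru p ih =>
    rw [bar_toHom_thru_comp_jonesWenzl, jonesWenzl_comp_toHom_thru, Hom.comp_assoc,
      ← Hom.comp_assoc (Hom.addRight _), ← Hom.addRight_comp, ih, addRight_comp_jonesWenzl,
      jonesWenzl_comp_self]
  | capd p ih =>
    rw [bar_toHom_capd_comp_jonesWenzl, jonesWenzl_comp_toHom_capd, Hom.comp_assoc,
      ← Hom.comp_assoc (Hom.addRight _), ← Hom.addRight_comp, ih,
      addRight_jonesWenzl_comp_cupRight, ← Hom.comp_assoc, capRight_comp_cupRight, Hom.id_comp]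

/-- If the last strands have the same type, the shorter paths differ and induction applies. If the
types differ and the shorter paths agree, the middle collapses to a projector absorbed by the larger
one, and the lone cup or cap is killed. -/
theorem jonesWenzl_toHom_of_ne {n s t : ℕ} (p : Path n s) (q : Path n t)
    (h : (⟨s, p⟩ : Σ t, Path n t) ≠ ⟨t, q⟩) :
    (jonesWenzl k s ⊚ p.toHom k) ⊚ (q.toHom k).bar ⊚ jonesWenzl k t = 0 := by
  induction p generalizing t with
  | nil =>
    cases q with
    | nil => exact absurd rfl h
  | thru p ih =>
    cases q with
    | thru q =>
      have h' := ih q (by rintro ⟨⟩; exact h rfl)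
      rw [bar_toHom_thru_comp_jonesWenzl, jonesWenzl_comp_toHom_thru, Hom.comp_assoc,
        ← Hom.comp_assoc (Hom.addRight _), ← Hom.addRight_comp, h', map_zero, Hom.zero_comp,
        Hom.comp_zero]
    | capd q =>
      rw [bar_toHom_capd_comp_jonesWenzl, jonesWenzl_comp_toHom_thru, Hom.comp_assoc,
        ← Hom.comp_assoc (Hom.addRight _), ← Hom.addRight_comp]
      by_cases e : (⟨_, p⟩ : Σ t, Path _ t) = ⟨_, q⟩
      · cases e
        rw [jonesWenzl_toHom_self, ← Hom.comp_assoc, jonesWenzl_comp_addRight,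
          jonesWenzl_comp_cupRight]
      · rw [ih q e, map_zero, Hom.zero_comp, Hom.comp_zero]
  | capd p ih =>
    cases q with
    | thru q =>
      rw [bar_toHom_thru_comp_jonesWenzl, jonesWenzl_comp_toHom_capd, Hom.comp_assoc,
        ← Hom.comp_assoc (Hom.addRight _), ← Hom.addRight_comp]
      by_cases e : (⟨_, p⟩ : Σ t, Path _ t) = ⟨_, q⟩
      · cases e
        rw [jonesWenzl_toHom_self, addRight_comp_jonesWenzl, capRight_comp_jonesWenzl]
      · rw [ih q e, map_zero, Hom.zero_comp, Hom.comp_zero]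
    | capd q =>
      have h' := ih q (by rintro ⟨⟩; exact h rfl)
      rw [bar_toHom_capd_comp_jonesWenzl, jonesWenzl_comp_toHom_capd, Hom.comp_assoc,
        ← Hom.comp_assoc (Hom.addRight _), ← Hom.addRight_comp, h', map_zero, Hom.zero_comp,
        Hom.comp_zero]

end toHom

end Path

/-! ### Cap diagrams encoded by paths, and reflection -/

namespace CapDiagram

variable {m n : ℕ}

/-- Transport of a cap diagram along an equality of numbers of strands. -/
def cast (h : m = n) (x : CapDiagram m) : CapDiagram n := h ▸ x

theorem cast_partner (h : m = n) (x : CapDiagram m) (i : Fin n) :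
    (x.cast h).partner i = (x.partner (i.cast h.symm)).cast h := by
  subst h
  rfl

theorem th_cast (h : m = n) (x : CapDiagram m) : (x.cast h).th = x.th := by
  subst h
  rfl

theorem cast_cast (h : m = n) (h' : n = m) (x : CapDiagram m) : (x.cast h).cast h' = x := by
  subst h
  rfl

theorem right_partner_of_natAdd {x : CapDiagram (m + n)} {i j : Fin n}
    (h : x.partner (Fin.natAdd m i) = Fin.natAdd m j) : x.right.partner i = j := by
  unfold right
  simp only [h, Fin.addCases_right]

theorem right_partner_of_castAdd {x : CapDiagram (m + n)} {i : Fin n} {j : Fin m}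
    (h : x.partner (Fin.natAdd m i) = Fin.castAdd n j) : x.right.partner i = i := by
  unfold right
  simp only [h, Fin.addCases_left]

/-- Deleting the first strand. -/
def tail (x : CapDiagram (n + 1)) : CapDiagram n :=
  right (m := 1) (x.cast (Nat.add_comm n 1))

/-- Deleting the last strand. -/
abbrev init (x : CapDiagram (n + 1)) : CapDiagram n := left (n := 1) x

theorem tail_of_succ {x : CapDiagram (n + 1)} {i j : Fin n} (h : x.partner i.succ = j.succ) :
    x.tail.partner i = j := by
  apply right_partner_of_natAdd
  have : (Fin.natAdd 1 i).cast (Nat.add_comm 1 n) = i.succ := by ext; simp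
  rw [cast_partner, this, h]
  ext
  simp [Nat.add_comm]

theorem tail_of_zero {x : CapDiagram (n + 1)} {i : Fin n} (h : x.partner i.succ = 0) :
    x.tail.partner i = i := by
  apply right_partner_of_castAdd (j := 0)
  have : (Fin.natAdd 1 i).cast (Nat.add_comm 1 n) = i.succ := by ext; simp
  rw [cast_partner, this, h]
  ext
  simp

theorem init_of_castSucc {x : CapDiagram (n + 1)} {i j : Fin n}
    (h : x.partner i.castSucc = j.castSucc) : x.init.partner i = j :=
  left_partner_of_castAdd h

theorem init_of_last {x : CapDiagram (n + 1)} {i : Fin n} (h : x.partner i.castSucc = Fin.last n) :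
    x.init.partner i = i :=
  left_partner_of_natAdd (j := 0) h

theorem reflect_partner (x : CapDiagram n) (i : Fin n) :
    x.reflect.partner i = (x.partner i.rev).rev := rfl

theorem tail_reflect (x : CapDiagram (n + 1)) : x.reflect.tail = x.init.reflect := by
  ext1
  funext i
  rw [reflect_partner]
  rcases Fin.eq_castSucc_or_eq_last (x.partner i.rev.castSucc) with ⟨j, h⟩ | h
  · rw [init_of_castSucc h]
    apply tail_of_succ
    rw [reflect_partner, Fin.rev_succ, h, Fin.rev_castSucc]
  · rw [init_of_last h, Fin.rev_rev]
    apply tail_of_zero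
    rw [reflect_partner, Fin.rev_succ, h, Fin.rev_last]

theorem init_tail (x : CapDiagram (n + 2)) : x.tail.init = x.init.tail := by
  ext1
  funext i
  have e : i.castSucc.succ = i.succ.castSucc := rfl
  rcases Fin.eq_zero_or_eq_succ (x.partner i.castSucc.succ) with h | ⟨j, h⟩
  · have h1 : x.init.partner i.succ = 0 := init_of_castSucc (by rw [← e, h]; rfl)
    rw [tail_of_zero h1]
    exact init_of_castSucc (tail_of_zero h)
  · rcases Fin.eq_castSucc_or_eq_last j with ⟨j, rfl⟩ | rfl
    · have h1 : x.init.partner i.succ = j.succ := init_of_castSucc (by rw [← e, h]; rfl)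
      rw [tail_of_succ h1]
      exact init_of_castSucc (tail_of_succ h)
    · have h1 : x.init.partner i.succ = i.succ := init_of_last (by rw [← e, h]; rfl)
      rw [tail_of_succ h1]
      exact init_of_last (tail_of_succ h)

theorem partner_eq_comm (x : CapDiagram n) {i j : Fin n} : x.partner i = j ↔ x.partner j = i := by
  constructor <;> rintro rfl <;> exact x.partner_partner _

theorem th_pos {x : CapDiagram n} {i : Fin n} (h : x.partner i = i) : 0 < x.th :=
  Finset.card_pos.mpr ⟨i, Finset.mem_filter.mpr ⟨Finset.mem_univ _, h⟩⟩

theorem init_zero_iff {x : CapDiagram (n + 2)} (h : x.partner 0 ≠ Fin.last _) :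
    x.init.partner 0 = 0 ↔ x.partner 0 = 0 := by
  rcases Fin.eq_castSucc_or_eq_last (x.partner 0) with ⟨j, h'⟩ | h'
  · rw [init_of_castSucc (i := 0) h', h']
    exact (Fin.castSucc_inj (b := 0)).symm
  · exact absurd h' h

theorem init_zero_of_joined {x : CapDiagram (n + 2)} (h : x.partner 0 = Fin.last _) :
    x.init.partner 0 = 0 := init_of_last (i := 0) h

theorem tail_last_iff {x : CapDiagram (n + 2)} (h : x.partner 0 ≠ Fin.last _) :
    x.tail.partner (Fin.last n) = Fin.last n ↔ x.partner (Fin.last _) = Fin.last _ := by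
  rcases Fin.eq_zero_or_eq_succ (x.partner (Fin.last (n + 1))) with h' | ⟨j, h'⟩
  · exact absurd (x.partner_eq_comm.mp h') h
  · rw [tail_of_succ (i := Fin.last n) h', h', ← Fin.succ_last, Fin.succ_inj]

theorem tail_last_of_joined {x : CapDiagram (n + 2)} (h : x.partner 0 = Fin.last _) :
    x.tail.partner (Fin.last n) = Fin.last n :=
  tail_of_zero (i := Fin.last n) (x.partner_eq_comm.mp h)

/-- All inner strands lie below the outer cap, hence are capped among themselves. -/
theorem th_init_tail_of_joined {x : CapDiagram (n + 2)} (h : x.partner 0 = Fin.last _) :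
    x.init.tail.th = 0 := by
  rw [th, Finset.card_eq_zero, Finset.filter_eq_empty_iff]
  intro i _ hi
  have h1 := x.nested 0 i.succ.castSucc (Fin.mk_lt_mk.mpr (Nat.succ_pos _))
    (by rw [h]; exact Fin.castSucc_lt_last _)
  rw [h] at h1
  rcases Fin.eq_castSucc_or_eq_last (x.partner i.succ.castSucc) with ⟨j, h2⟩ | h2
  · rcases Fin.eq_zero_or_eq_succ j with rfl | ⟨j, rfl⟩
    · rw [h2] at h1
      exact lt_irrefl _ h1.1
    · rw [tail_of_succ (init_of_castSucc h2)] at hi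
      rw [hi] at h2
      exact h1.2.2 h2
  · exact h1.2.1.ne h2

theorem th_tail_pos {x : CapDiagram (n + 1)} (h : x.partner 0 ≠ 0) : 0 < x.tail.th := by
  rcases Fin.eq_zero_or_eq_succ (x.partner 0) with h' | ⟨j, h'⟩
  · exact absurd h' h
  · exact th_pos (tail_of_zero (x.partner_eq_comm.mp h'))

/-- A capped last strand is joined to the rightmost through strand among the preceding ones. -/
theorem init_of_partner_last {x : CapDiagram (n + 1)} {a : Fin n}
    (h : x.partner (Fin.last n) = a.castSucc) :
    x.init.partner a = a ∧ ∀ j, a < j → x.init.partner j ≠ j := by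
  have h' := x.partner_eq_comm.mp h
  refine ⟨init_of_last h', fun j hj e => ?_⟩
  have h1 := x.nested a.castSucc j.castSucc hj (by rw [h']; exact Fin.castSucc_lt_last _)
  rw [h'] at h1
  rcases Fin.eq_castSucc_or_eq_last (x.partner j.castSucc) with ⟨i, h2⟩ | h2
  · rw [init_of_castSucc h2] at e
    rw [e] at h2
    exact h1.2.2 h2
  · exact h1.2.1.ne h2

/-- The partner of a capped last strand is forced: it is the rightmost through strand of `x.init`.
One bit about the last strand therefore suffices, which is why paths encode diagrams. -/
theorem ext_init {x y : CapDiagram (n + 1)} (h : x.init = y.init)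
    (hl : x.partner (Fin.last n) = Fin.last n ↔ y.partner (Fin.last n) = Fin.last n) : x = y := by
  have key : x.partner (Fin.last n) = y.partner (Fin.last n) := by
    rcases Fin.eq_castSucc_or_eq_last (x.partner (Fin.last n)) with ⟨a, ha⟩ | ha
    · rcases Fin.eq_castSucc_or_eq_last (y.partner (Fin.last n)) with ⟨b, hb⟩ | hb
      · obtain ⟨h1, h2⟩ := init_of_partner_last ha
        obtain ⟨h3, h4⟩ := init_of_partner_last hb
        rw [← h] at h3 h4
        rcases lt_trichotomy a b with hab | rfl | hab
        · exact absurd h3 (h2 b hab)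
        · rw [ha, hb]
        · exact absurd h1 (h4 a hab)
      · rw [hb, hl.mpr hb]
    · rw [ha, hl.mp ha]
  ext1
  funext i
  rcases Fin.eq_castSucc_or_eq_last i with ⟨i, rfl⟩ | rfl
  · rcases Fin.eq_castSucc_or_eq_last (x.partner i.castSucc) with ⟨a, ha⟩ | ha
    · rcases Fin.eq_castSucc_or_eq_last (y.partner i.castSucc) with ⟨b, hb⟩ | hb
      · rw [ha, hb, ← init_of_castSucc ha, ← init_of_castSucc hb, h]
      · have := y.partner_eq_comm.mp hb
        rw [← key] at this
        rw [hb, x.partner_eq_comm.mp this]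
    · have := x.partner_eq_comm.mp ha
      rw [key] at this
      rw [ha, y.partner_eq_comm.mp this]
  · exact key

theorem castAdd_ne_natAdd (i : Fin m) (j : Fin n) : Fin.castAdd n i ≠ Fin.natAdd m j := by
  intro e
  rw [Fin.ext_iff] at e
  simp at e
  omega

theorem left_hookOnce (x : CapDiagram (m + n)) : x.hookOnce.left = x.left := by
  by_cases h : x.thruL.Nonempty ∧ x.thruR.Nonempty
  · ext1
    funext i
    rw [hookOnce, dif_pos h]
    by_cases hi : i = x.thruL.max' h.1
    · have h1 : x.partner (Fin.castAdd n i) = Fin.castAdd n i := by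
        rw [hi]
        exact (Finset.mem_filter.mp (x.thruL.max'_mem h.1)).2
      rw [left_partner_of_castAdd h1]
      apply left_partner_of_natAdd (j := x.thruR.min' h.2)
      simp [join, hi]
    · apply left_partner_congr
      simp [join, hi, castAdd_ne_natAdd]
  · rw [hookOnce, dif_neg h]

theorem left_concat (y : CapDiagram m) (y' : CapDiagram n) : (y.concat y').left = y := by
  ext1
  funext i
  apply left_partner_of_castAdd
  simp [concat]

theorem left_hook (l : ℕ) (y : CapDiagram m) (y' : CapDiagram n) : (hook l y y').left = y := by
  rw [hook]
  induction l with
  | zero => exact left_concat y y'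
  | succ l ih => rw [Function.iterate_succ_apply', left_hookOnce, ih]

/-- The diagram on one strand. -/
def single : CapDiagram 1 where
  partner i := i
  partner_partner _ := rfl
  nested i j h := absurd (Subsingleton.elim i j) h.ne

theorem th_single : single.th = 1 := rfl

/-- `x` is the cap diagram encoded by the path `p`. -/
def Codes : ∀ {n t : ℕ}, CapDiagram n → Path n t → Prop
  | _, _, _, .nil => True
  | _, _, x, .thru p => x.partner (Fin.last _) = Fin.last _ ∧ Codes x.init p
  | _, _, x, .capd p => x.partner (Fin.last _) ≠ Fin.last _ ∧ Codes x.init p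

theorem Codes.th_eq {t : ℕ} {x : CapDiagram n} {p : Path n t} (h : Codes x p) : x.th = t := by
  induction p with
  | nil => simp [th]
  | thru p ih => rw [← th_left_of_last_fixed x h.1, ih h.2]
  | capd p ih =>
    have := th_left_of_last_capped x h.1
    rw [ih h.2] at this
    omega

theorem exists_codes (x : CapDiagram n) {t : ℕ} (h : x.th = t) : ∃ p : Path n t, Codes x p := by
  induction n generalizing t with
  | zero =>
    obtain rfl : 0 = t := by rw [← h]; simp [th]
    exact ⟨.nil, trivial⟩
  | succ n ih =>
    by_cases hl : x.partner (Fin.last n) = Fin.last n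
    · have := th_left_of_last_fixed x hl
      obtain ⟨p, hp⟩ := ih x.init rfl
      rw [h] at this
      subst this
      exact ⟨p.thru, hl, hp⟩
    · obtain ⟨p, hp⟩ := ih x.init ((th_left_of_last_capped x hl).trans (congrArg (· + 1) h))
      exact ⟨p.capd, hl, hp⟩

theorem Codes.path_unique {t : ℕ} {x : CapDiagram n} {p q : Path n t} (hp : Codes x p)
    (hq : Codes x q) : p = q := by
  induction p with
  | nil =>
    cases q
    rfl
  | thru p ih =>
    cases q with
    | thru q => rw [ih hp.2 hq.2]
    | capd q => exact absurd hp.1 hq.1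
  | capd p ih =>
    cases q with
    | thru q => exact absurd hq.1 hp.1
    | capd q => rw [ih hp.2 hq.2]

theorem Codes.diagram_unique {t : ℕ} {x y : CapDiagram n} {p : Path n t} (hx : Codes x p)
    (hy : Codes y p) : x = y := by
  induction p with
  | nil =>
    ext1
    exact Subsingleton.elim _ _
  | thru p ih => exact ext_init (ih hx.2 hy.2) (iff_of_true hx.1 hy.1)
  | capd p ih => exact ext_init (ih hx.2 hy.2) (iff_of_false hx.1 hy.1)

/-- Append one strand, hooked once in the capped case. The number of through strands then reveals
the type of the last strand without inspecting its partner. -/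
theorem exists_codes_of_path {t : ℕ} (p : Path n t) : ∃ x : CapDiagram n, Codes x p := by
  induction p with
  | nil => exact ⟨⟨fun i => i, fun _ => rfl, fun i => i.elim0⟩, trivial⟩
  | thru p ih =>
    obtain ⟨x, hx⟩ := ih
    refine ⟨x.concat single, ?_, by rwa [init, left_concat]⟩
    by_contra h
    have h1 := th_left_of_last_capped _ h
    have h2 := (x.concat single).th_eq
    rw [thruL_concat, thruR_concat, th_single] at h2
    rw [left_concat] at h1
    omega
  | capd p ih =>
    obtain ⟨x, hx⟩ := ih
    refine ⟨hook 1 x single, fun h => ?_, by rwa [init, left_hook]⟩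
    have h1 := th_left_of_last_fixed _ h
    have h2 := th_hook 1 x single (by rw [hx.th_eq]; omega) (by rw [th_single])
    rw [th_single] at h2
    rw [left_hook] at h1
    omega

theorem Codes.toHom_eq {k : Type*} [CommRing k] {t : ℕ} {x : CapDiagram n} {p : Path n t}
    (hp : Codes x p) (h : x.th = t) : (x.toHom k).cast rfl h = p.toHom k := by
  induction p with
  | nil =>
    rw [toHom]
    simp [Path.toHom]
  | thru p ih =>
    rw [toHom_of_fixed hp.1, Path.toHom, ← ih hp.2 hp.2.th_eq, Hom.addRight_cast, Hom.cast_cast]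
  | capd p ih =>
    rw [toHom_of_capped hp.1, Path.toHom, ← ih hp.2 hp.2.th_eq, Hom.addRight_cast]
    subst h
    rfl

theorem codes_thruLeft {t : ℕ} {x : CapDiagram (n + 1)} {p : Path n t} (h : x.partner 0 = 0)
    (hp : Codes x.tail p) : Codes x p.thruLeft := by
  induction p with
  | nil => exact ⟨h, trivial⟩
  | thru p ih =>
    have h0 : x.partner 0 ≠ Fin.last _ := by rw [h]; exact (Fin.last_pos).ne
    refine ⟨(tail_last_iff h0).mp hp.1, ih ((init_zero_iff h0).mpr h) ?_⟩
    rw [← init_tail]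
    exact hp.2
  | capd p ih =>
    have h0 : x.partner 0 ≠ Fin.last _ := by rw [h]; exact (Fin.last_pos).ne
    refine ⟨mt (tail_last_iff h0).mpr hp.1, ih ((init_zero_iff h0).mpr h) ?_⟩
    rw [← init_tail]
    exact hp.2

theorem codes_capdLeft {t : ℕ} {x : CapDiagram (n + 1)} {p : Path n (t + 1)}
    (h : x.partner 0 ≠ 0) (hp : Codes x.tail p) : Codes x p.capdLeft := by
  induction n generalizing t with
  | zero => nomatch p
  | succ n ih =>
    cases p with
    | thru p =>
      obtain ⟨hl, hp⟩ := hp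
      rw [init_tail] at hp
      -- A cap from first to last strand leaves no through strand inside, so `t = 0` and the
      -- exceptional clause of `Path.capdLeft` applies. Otherwise the first strand is still capped
      -- in `x.init`, which rules out `t = 0`.
      by_cases h0 : x.partner 0 = Fin.last _
      · have ht := th_init_tail_of_joined h0
        rw [hp.th_eq] at ht
        subst ht
        refine ⟨fun h1 => ?_, codes_thruLeft (init_zero_of_joined h0) hp⟩
        rw [x.partner_eq_comm.mp h0] at h1
        exact (Fin.last_pos).ne h1
      · have h1 := mt (init_zero_iff h0).mp h
        cases t with
        | zero => exact absurd hp.th_eq (th_tail_pos h1).ne'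
        | succ t => exact ⟨(tail_last_iff h0).mp hl, ih h1 hp⟩
    | capd p =>
      obtain ⟨hl, hp⟩ := hp
      rw [init_tail] at hp
      have h0 : x.partner 0 ≠ Fin.last _ := fun h0 => hl (tail_last_of_joined h0)
      rw [Path.capdLeft]
      exact ⟨mt (tail_last_iff h0).mpr hl, ih (mt (init_zero_iff h0).mp h) hp⟩

theorem Codes.reflect {t : ℕ} {x : CapDiagram n} {p : Path n t} (hp : Codes x p) :
    Codes x.reflect p.reflect := by
  induction p with
  | nil => trivial
  | thru p ih =>
    refine codes_thruLeft ?_ ?_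
    · rw [reflect_partner, Fin.rev_zero, hp.1, Fin.rev_last]
    · rw [tail_reflect]
      exact ih hp.2
  | capd p ih =>
    refine codes_capdLeft ?_ ?_
    · rw [reflect_partner, Fin.rev_zero]
      intro h
      rw [Fin.rev_eq_iff, Fin.rev_zero] at h
      exact hp.1 h
    · rw [tail_reflect]
      exact ih hp.2

end CapDiagram

/-! ### The map `κ_{1,n}` on paths -/

/-- Moving the first strand to the last position, keeping it a through strand or capped. -/
def Path.rotate {n t : ℕ} (p : Path (n + 1) t) : Path (n + 1) t :=
  match p.reflect with
  | .thru q => q.reflect.thru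
  | .capd q => q.reflect.capd

namespace CapDiagram

variable {n : ℕ}

/-- Hooking does not alter the diagram obtained by deleting the right-hand factor, so `κ_{1,n}(x)`
without its last strand is `x` without its first. The type of that last strand is then fixed by
`th_kappa`. -/
theorem Codes.kappa {t : ℕ} {x : CapDiagram (1 + n)} {p : Path (n + 1) t}
    (hp : Codes (x.cast (Nat.add_comm 1 n)) p) :
    Codes (CapDiagram.kappa 1 n x) p.rotate := by
  set y := x.cast (Nat.add_comm 1 n) with hy
  have hth : (CapDiagram.kappa 1 n x).th = t := by
    rw [th_kappa, ← th_cast (Nat.add_comm 1 n), hp.th_eq]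
  have hinit : (CapDiagram.kappa 1 n x).init = y.tail := by
    rw [init, CapDiagram.kappa, left_hook, tail, hy, cast_cast]
  obtain ⟨q, hq⟩ := exists_codes y.tail rfl
  by_cases h : y.partner 0 = 0
  · have h1 := codes_thruLeft h hq
    have ht := h1.th_eq.symm.trans hp.th_eq
    subst ht
    rw [hp.path_unique h1, Path.rotate, Path.reflect_thruLeft]
    simp only [Path.reflect_reflect]
    refine ⟨?_, by rwa [hinit]⟩
    by_contra hl
    have := th_left_of_last_capped _ hl
    rw [hth, show left (n := 1) _ = _ from hinit] at this
    omega
  · obtain ⟨s, hs⟩ : ∃ s, y.tail.th = s + 1 := Nat.exists_eq_succ_of_ne_zero (th_tail_pos h).ne'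
    obtain ⟨q, hq⟩ := exists_codes y.tail hs
    have h1 := codes_capdLeft h hq
    have ht := h1.th_eq.symm.trans hp.th_eq
    subst ht
    rw [hp.path_unique h1, Path.rotate, Path.reflect_capdLeft]
    simp only [Path.reflect_reflect]
    refine ⟨fun hl => ?_, by rwa [hinit]⟩
    have := th_left_of_last_fixed _ hl
    rw [hth, show left (n := 1) _ = _ from hinit] at this
    omega

end CapDiagram

/-! ### Matrix units; the commutor and the reversal as sums of them -/

/-- Cap diagrams on `n` strands correspond to paths. -/
noncomputable def codeEquiv (n : ℕ) : CapDiagram n ≃ Σ t, Path n t :=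
  Equiv.ofBijective (fun x => ⟨x.th, (x.exists_codes rfl).choose⟩) (by
    have hc : ∀ x : CapDiagram n, x.Codes (x.exists_codes rfl).choose :=
      fun x => (x.exists_codes rfl).choose_spec
    constructor
    · intro x y h
      have hx := hc x
      have hy := hc y
      dsimp only at h
      generalize (x.exists_codes rfl).choose = p at *
      generalize (y.exists_codes rfl).choose = q at *
      generalize x.th = s at *
      generalize y.th = t at *
      cases h
      exact hx.diagram_unique hy
    · rintro ⟨t, p⟩
      obtain ⟨x, hx⟩ := CapDiagram.exists_codes_of_path p
      obtain rfl := hx.th_eq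
      exact ⟨x, congrArg (Sigma.mk _) ((hc x).path_unique hx)⟩)

theorem codes_codeEquiv {n : ℕ} (x : CapDiagram n) : x.Codes (codeEquiv n x).2 :=
  (x.exists_codes rfl).choose_spec

noncomputable instance (n : ℕ) : Fintype (Σ t, Path n t) := Fintype.ofEquiv _ (codeEquiv n)

noncomputable instance (n : ℕ) : Fintype (Σ t, Path n (t + 1)) :=
  Fintype.ofInjective (β := Σ t, Path n t) (fun x => ⟨x.1 + 1, x.2⟩) (by
    rintro ⟨s, p⟩ ⟨t, q⟩ h
    cases h
    rfl)

theorem Hom.cast_sum {a b a' b' : ℕ} {ι : Type*} (s : Finset ι) (f : ι → Hom k a b) (ha : a = a')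
    (hb : b = b') : (∑ i ∈ s, f i).cast ha hb = ∑ i ∈ s, (f i).cast ha hb := by
  subst ha hb
  rfl

theorem Hom.id_tensor_addLeft (a : ℕ) {b c : ℕ} (f : Hom k b c) :
    Hom.id k a ⊠ Hom.addLeft f =
      (Hom.id k (a + 1) ⊠ f).cast (by omega) (by omega) := by
  change Hom.id k a ⊠ Hom.cast _ _ _ = _
  conv_lhs => rw [← Hom.cast_rfl (Hom.id k a) rfl rfl]
  rw [Hom.cast_tensor_cast, ← Hom.tensor_assoc, Hom.cast_cast, Hom.tensor_id]

/-- The morphism `q̄ ∘ j_t ∘ p` for paths `p` and `q`. -/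
noncomputable def pathUnit (k : Type*) [CommRing k] {m n t : ℕ} (q : Path n t) (p : Path m t) :
    Hom k m n :=
  (q.toHom k).bar ⊚ jonesWenzl k t ⊚ p.toHom k

theorem maxSummand_eq {m n t : ℕ} {y : CapDiagram n} {x : CapDiagram m} (h : y.th = x.th)
    {q : Path n t} {p : Path m t} (hy : y.Codes q) (hx : x.Codes p) :
    maxSummand k y x h = pathUnit k q p := by
  obtain rfl := hx.th_eq
  rw [maxSummand, pathUnit, ← hx.toHom_eq rfl, ← hy.toHom_eq h, Hom.cast_bar]
  rfl

theorem pathUnit_comp_self {l m n t : ℕ} (r : Path n t) (q : Path m t) (p : Path l t) :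
    pathUnit k r q ⊚ pathUnit k q p = pathUnit k r p := by
  have h : pathUnit k r q ⊚ pathUnit k q p = (r.toHom k).bar ⊚ ((jonesWenzl k t ⊚ q.toHom k) ⊚
      (q.toHom k).bar ⊚ jonesWenzl k t) ⊚ p.toHom k := by
    simp only [pathUnit, Hom.comp_assoc]
  rw [h, Path.jonesWenzl_toHom_self, pathUnit]

theorem pathUnit_comp_of_ne {l m n s t : ℕ} (r : Path n s) (q' : Path m s) (q : Path m t)
    (p : Path l t) (hne : (⟨s, q'⟩ : Σ t, Path m t) ≠ ⟨t, q⟩) :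
    pathUnit k r q' ⊚ pathUnit k q p = 0 := by
  have h : pathUnit k r q' ⊚ pathUnit k q p = (r.toHom k).bar ⊚ ((jonesWenzl k s ⊚ q'.toHom k) ⊚
      (q.toHom k).bar ⊚ jonesWenzl k t) ⊚ p.toHom k := by
    simp only [pathUnit, Hom.comp_assoc]
  rw [h, Path.jonesWenzl_toHom_of_ne _ _ hne, Hom.zero_comp, Hom.comp_zero]

/-- By orthogonality only the summand indexed by `q` survives. -/
theorem sum_pathUnit_comp {m n l t : ℕ} (f : ∀ {t : ℕ}, Path m t → Path n t) (q : Path m t)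
    (p : Path l t) :
    (∑ x : Σ t, Path m t, pathUnit k (f x.2) x.2) ⊚ pathUnit k q p = pathUnit k (f q) p := by
  rw [Hom.sum_comp, Fintype.sum_eq_single ⟨t, q⟩]
  · exact pathUnit_comp_self _ _ _
  · rintro ⟨s, r⟩ h
    exact pathUnit_comp_of_ne _ _ _ _ h

theorem addLeft_pathUnit_zero {m n : ℕ} (q : Path n 0) (p : Path m 0) :
    Hom.addLeft (pathUnit k q p) = pathUnit k q.thruLeft p.thruLeft := by
  rw [pathUnit, pathUnit, Path.toHom_thruLeft, Path.toHom_thruLeft, ← Hom.addLeft_bar,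
    jonesWenzl_zero, Hom.addLeft_comp, Hom.addLeft_comp, Hom.addLeft_id]
  congr 2
  exact jonesWenzl_one.symm

/-- The two terms are those of `addLeft_jonesWenzl`, with the left cup and cap absorbed into the
diagrams. -/
theorem addLeft_pathUnit_succ {m n t : ℕ} (q : Path n (t + 1)) (p : Path m (t + 1)) :
    Hom.addLeft (pathUnit k q p) =
      pathUnit k q.thruLeft p.thruLeft + pathUnit k q.capdLeft p.capdLeft := by
  simp only [pathUnit, Path.toHom_thruLeft, Path.toHom_capdLeft, Hom.bar_comp, ← Hom.addLeft_bar,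
    Hom.addLeft_comp, addLeft_jonesWenzl, Hom.comp_add, Hom.add_comp, Hom.comp_assoc, cupLeft]

/-- The sum over all cap diagrams `x` of the morphisms given by `x`, a Jones-Wenzl projector and the
upside-down reflection of `x`. -/
noncomputable def reversal (k : Type*) [CommRing k] (n : ℕ) : Hom k n n :=
  ∑ x : CapDiagram n, maxSummand k x.reflect x x.th_reflect

theorem reversal_eq (n : ℕ) :
    reversal k n = ∑ x : Σ t, Path n t, pathUnit k x.2.reflect x.2 := by
  rw [reversal, ← (codeEquiv n).sum_comp]
  exact Finset.sum_congr rfl fun x _ =>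
    maxSummand_eq _ (codes_codeEquiv x).reflect (codes_codeEquiv x)

theorem maxSummand_cast {l m n : ℕ} (y : CapDiagram n) (x : CapDiagram m) (h : y.th = x.th)
    (e : m = l) : (maxSummand k y x h).cast e rfl =
      maxSummand k y (x.cast e) (h.trans (x.th_cast e).symm) := by
  subst e
  rfl

theorem commutor_one_eq (n : ℕ) :
    (commutor k 1 n).cast (Nat.add_comm 1 n) rfl =
      ∑ x : Σ t, Path (n + 1) t, pathUnit k x.2.rotate x.2 := by
  have h : (commutor k 1 n).cast (Nat.add_comm 1 n) rfl = ∑ x : CapDiagram (1 + n),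
      (maxSummand k (CapDiagram.kappa 1 n x) x (CapDiagram.th_kappa x)).cast
        (Nat.add_comm 1 n) rfl := by
    rw [commutor, Hom.cast_sum]
  let e : CapDiagram (1 + n) ≃ CapDiagram (n + 1) :=
    ⟨CapDiagram.cast (Nat.add_comm 1 n), CapDiagram.cast (Nat.add_comm n 1),
      CapDiagram.cast_cast _ _, CapDiagram.cast_cast _ _⟩
  rw [h, ← (e.trans (codeEquiv _)).sum_comp]
  refine Finset.sum_congr rfl fun x _ => ?_
  rw [maxSummand_cast]
  exact maxSummand_eq _ (codes_codeEquiv (e x)).kappa (codes_codeEquiv (e x))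

/-- The first strand of a path on `n + 1` strands is either through or capped; deleting it gives a
unique preimage under `thruLeft` or `capdLeft`, the latter only from paths having a through strand.
-/
theorem sum_path_succ {M : Type*} [AddCommMonoid M] {n : ℕ} (f : (Σ t, Path (n + 1) t) → M)
    (g : (Σ t, Path n t) → M) (h0 : ∀ p : Path n 0, g ⟨0, p⟩ = f ⟨1, p.thruLeft⟩)
    (h : ∀ t, ∀ p : Path n (t + 1),
      g ⟨t + 1, p⟩ = f ⟨t + 2, p.thruLeft⟩ + f ⟨t, p.capdLeft⟩) :
    ∑ x, g x = ∑ x, f x := by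
  let e : (Σ t, Path n t) ⊕ (Σ t, Path n (t + 1)) → Σ t, Path (n + 1) t :=
    Sum.elim (fun x => ⟨x.1 + 1, x.2.thruLeft⟩) (fun x => ⟨x.1, x.2.capdLeft⟩)
  have he : Function.Bijective e := by
    constructor
    · rintro (⟨s, p⟩ | ⟨s, p⟩) (⟨t, q⟩ | ⟨t, q⟩) h <;> obtain ⟨h1, h2⟩ := Sigma.mk.inj h
      · obtain rfl : s = t := Nat.succ.inj h1
        cases Path.thruLeft_injective (eq_of_heq h2)
        rfl
      · obtain rfl : s + 1 = t := h1
        exact absurd (eq_of_heq h2) (Path.thruLeft_ne_capdLeft _ _)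
      · obtain rfl : s = t + 1 := h1
        exact absurd (eq_of_heq h2).symm (Path.thruLeft_ne_capdLeft _ _)
      · obtain rfl : s = t := h1
        cases Path.capdLeft_injective (eq_of_heq h2)
        rfl
    · rintro ⟨t, p⟩
      -- The first strand of `p` is the last strand of its reflection, so its type is read off from
      -- the final constructor there.
      rw [← p.reflect_reflect]
      generalize p.reflect = r
      cases r with
      | thru q => exact ⟨.inl ⟨_, q.reflect⟩, rfl⟩
      | capd q => exact ⟨.inr ⟨_, q.reflect⟩, rfl⟩
  -- Extension by zero to paths without through strands, so that both sums run over the same index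
  -- type.
  let b : (Σ t, Path n t) → M
    | ⟨0, _⟩ => 0
    | ⟨t + 1, p⟩ => f ⟨t, p.capdLeft⟩
  have hb : ∑ x : Σ t, Path n (t + 1), f ⟨x.1, x.2.capdLeft⟩ = ∑ x, b x := by
    refine Fintype.sum_of_injective (fun x => ⟨x.1 + 1, x.2⟩) ?_ _ _ ?_ fun x => rfl
    · rintro ⟨s, p⟩ ⟨t, q⟩ h
      cases h
      rfl
    · rintro ⟨_ | t, p⟩ h
      · rfl
      · exact absurd ⟨⟨t, p⟩, rfl⟩ h
  rw [← (Equiv.ofBijective e he).sum_comp, Fintype.sum_sum_type]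
  refine Eq.trans ?_ (congrArg (_ + ·) hb.symm)
  rw [← Finset.sum_add_distrib]
  refine Finset.sum_congr rfl fun x _ => ?_
  obtain ⟨_ | t, p⟩ := x
  · rw [h0]
    exact (add_zero _).symm
  · exact h t p

theorem rotate_thruLeft_reflect {n t : ℕ} (p : Path n t) :
    p.reflect.thruLeft.rotate = p.thruLeft.reflect := by
  rw [Path.rotate, Path.reflect_thruLeft, Path.reflect_thruLeft]
  simp only [Path.reflect_reflect]

theorem rotate_capdLeft_reflect {n t : ℕ} (p : Path n (t + 1)) :
    p.reflect.capdLeft.rotate = p.capdLeft.reflect := by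
  rw [Path.rotate, Path.reflect_capdLeft, Path.reflect_capdLeft]
  simp only [Path.reflect_reflect]

/-- The inductive step of the theorem: the terms of `1 ⊗ c(ϑ(x), x)` are matrix units, on which the
commutor rotates the upper diagram into the reflection of the lower one. -/
theorem commutor_comp_addLeft_reversal (n : ℕ) :
    (commutor k 1 n).cast (Nat.add_comm 1 n) rfl ⊚ Hom.addLeft (reversal k n) =
      reversal k (n + 1) := by
  rw [commutor_one_eq, reversal_eq, reversal_eq, map_sum, Hom.comp_sum]
  refine sum_path_succ (fun x => pathUnit k x.2.reflect x.2) _ (fun p => ?_) fun t p => ?_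
  · rw [addLeft_pathUnit_zero, sum_pathUnit_comp Path.rotate, rotate_thruLeft_reflect]
  · rw [addLeft_pathUnit_succ, Hom.comp_add, sum_pathUnit_comp Path.rotate,
      sum_pathUnit_comp Path.rotate, rotate_thruLeft_reflect, rotate_capdLeft_reflect]

theorem reversal_zero : reversal k 0 = Hom.id k 0 := by
  rw [reversal_eq, Fintype.sum_eq_single ⟨0, .nil⟩]
  · simp [pathUnit, Path.reflect, Path.toHom]
  · rintro ⟨_, ⟨⟩⟩ h
    exact absurd rfl h

theorem reversal_one : reversal k 1 = Hom.id k 1 := by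
  rw [reversal_eq, ← sum_path_succ (fun x : Σ t, Path 1 t => pathUnit k x.2.reflect x.2)
    (fun x => Hom.addLeft (pathUnit k x.2.reflect x.2))
    (fun p => by rw [addLeft_pathUnit_zero]; cases p; rfl) (fun t p => nomatch p), ← map_sum,
    ← reversal_eq, reversal_zero, Hom.addLeft_id]

/-! ### Intervals inside `n` strands -/

theorem commutorAt_eq {n p q a d c : ℕ} (h : 1 ≤ p ∧ p ≤ p ∧ p < q ∧ q ≤ n) (ha : p - 1 = a)
    (hd : q - p = d) (hc : n - q = c) :
    commutorAt k n p p q h =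
      (Hom.id k a ⊠ (commutor k 1 d).cast (Nat.add_comm 1 d) rfl ⊠ Hom.id k c).cast (by omega)
        (by omega) := by
  -- The first argument of the commutor is `p - p + 1`, which equals `1` only propositionally, so it
  -- is replaced by a variable `m`.
  have key : ∀ m, m = 1 → ∀ h1 h2, (Hom.id k a ⊠ commutor k m d ⊠ Hom.id k c).cast h1 h2 =
      (Hom.id k a ⊠ (commutor k 1 d).cast (Nat.add_comm 1 d) rfl ⊠ Hom.id k c).cast
        (a' := n) (b' := n) (by omega) (by omega) := by
    rintro m rfl h1 h2
    rw [← Hom.cast_rfl (Hom.id k a) rfl rfl, Hom.cast_tensor_cast,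
      ← Hom.cast_rfl (Hom.id k c) rfl rfl, Hom.cast_tensor_cast, Hom.cast_cast]
    rfl
  subst ha hd hc
  exact key _ (by omega) _ _

/-- The strand added on the left of the shorter reversal is regrouped with the `a` identity strands;
the interchange law does the rest. -/
theorem tensor_reversal_succ {n a d c : ℕ} (h : a + (d + 1) + c = n)
    (h' : a + 1 + d + c = n) :
    (Hom.id k a ⊠ reversal k (d + 1) ⊠ Hom.id k c).cast h h =
      (Hom.id k a ⊠ (commutor k 1 d).cast (Nat.add_comm 1 d) rfl ⊠ Hom.id k c).cast h h ⊚
        (Hom.id k (a + 1) ⊠ reversal k d ⊠ Hom.id k c).cast h' h' := by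
  subst h
  have e : (Hom.id k (a + 1) ⊠ reversal k d ⊠ Hom.id k c).cast h' h' =
      Hom.id k a ⊠ Hom.addLeft (reversal k d) ⊠ Hom.id k c := by
    rw [Hom.id_tensor_addLeft]
    conv_rhs => rw [← Hom.cast_rfl (Hom.id k c) rfl rfl]
    rw [Hom.cast_tensor_cast]
  rw [e, ← commutor_comp_addLeft_reversal, Hom.cast_rfl, Hom.cast_rfl, ← Hom.interchange,
    ← Hom.interchange, Hom.id_comp, Hom.id_comp]

theorem intervalReversal_eq {n a d c : ℕ} (p q : ℕ) (h : 1 ≤ p ∧ p < q ∧ q ≤ n)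
    (ha : p - 1 = a) (hd : q - p = d) (hc : n - q = c) :
    intervalReversal k n p q h =
      (Hom.id k a ⊠ reversal k (d + 1) ⊠ Hom.id k c).cast (by omega) (by omega) := by
  induction d generalizing p a with
  | zero => omega
  | succ d ih =>
    rw [tensor_reversal_succ _ (by omega), ← commutorAt_eq ⟨h.1, le_rfl, h.2⟩ ha hd hc,
      intervalReversal]
    by_cases hq : q = p + 1
    -- For two strands the inner factor is the reversal of one strand, an identity, so the recursion
    -- agrees with `s_{p,p+1} = σ_{p,p,p+1}`.
    · obtain rfl : d = 0 := by omega
      have h1 : reversal k (0 + 1) = Hom.id k 1 := reversal_one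
      rw [dif_pos hq, h1, Hom.tensor_id, Hom.tensor_id, Hom.cast_id, Hom.comp_id]
    · rw [dif_neg hq, ih (a := a + 1) (p + 1) ⟨by omega, by omega, h.2.2⟩ (by omega) (by omega)]

end CrysTL

theorem mainTheorem11 (k : Type*) [Field k] (n p q : ℕ) (hp : 1 ≤ p) (hpq : p < q) (hqn : q ≤ n) :
    CrysTL.intervalReversal k n p q ⟨hp, hpq, hqn⟩ =
      (CrysTL.Hom.id k (p - 1) ⊠
        (∑ x : CrysTL.CapDiagram (q - p + 1),
          (x.reflect.toHom k).bar.cast x.th_reflect rfl ⊚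
            CrysTL.jonesWenzl k x.th ⊚ x.toHom k) ⊠
        CrysTL.Hom.id k (n - q)).cast (by omega) (by omega) :=
  CrysTL.intervalReversal_eq p q ⟨hp, hpq, hqn⟩ rfl rfl rfl
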